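/- Let $K$ be a number field with absolute Galois group $G_K$, let $F$ be a totally real number field with a fixed embedding $F\hookrightarrow\mathbb R$ (which defines $\operatorname{sign}\colon F^*\to\{\pm1\}$), and let $\mathcal B$ be a totally indefinite division quaternion algebra with centre $F$. Let $G_K$ act trivially on $F^*$, which is given the discrete topology, and put $P=F^*/\{\pm1\}$. For a continuous morphism $\psi\colon G_K\to\mathcal B^*/F^*$ ($\mathcal B^*/F^*$ discrete), choose a continuous lift $\sigma\mapsto\psi_\sigma\in\mathcal B^*$ and let $\delta(\psi)\in H^2(G_K,F^*)$ be the class of the continuous cocycle $(\sigma,\tau)\mapsto\psi_\sigma\psi_\tau\psi_{\sigma\tau}^{-1}$. Let $\Delta_{C_2\times C_2}$ be the set of $\gamma\in H^2(G_K,F^*)[2]$ of the form $\gamma=\delta(\psi)$ for some continuous morphism $\psi$ with image isomorphic to $C_2\times C_2$. For $\gamma=[c]\in H^2(G_K,F^*)$ let $\gamma_\pm\in H^2(G_K,\{\pm1\})$ be the class of $\operatorname{sign}\circ c$. If $\gamma^2=1$, write $c(\sigma,\tau)^2=d_\sigma d_\tau d_{\sigma\tau}^{-1}$ with $d\colon G_K\to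 F^*$ continuous, and let $\overline\gamma\in\operatorname{Hom}(G_K,P/P^2)$ be the morphism sending $\sigma$ to the class of $d_\sigma$. For $t\in K$ and $d\in F^*$ let $(t,d)_P\in\operatorname{Hom}(G_K,P/P^2)$ be the morphism sending $\sigma$ to $1$ if $\sigma$ fixes $\sqrt t$ and to the class of $d$ otherwise. For a field $k$ and $a,b\in k^*$, $(a,b)_k$ is the quaternion algebra over $k$ generated by $i,j$ with $i^2=a$, $j^2=b$, $ij=-ji$; quaternion algebras over $K$ are identified with elements of $H^2(G_K,\{\pm1\})\simeq \operatorname{Br}(K)[2]$. Then $\gamma\in H^2(G_K,F^*)$ lies in $\Delta_{C_2\times C_2}$ if and only if $\gamma^2=1$ and there exist $s,t\in K$ such that none of $s$, $t$, $st$ is a square in $K$, and $a,b\in F^*$ with $a$ positive and $\mathcal B\simeq(a,b)_F$, such that $$\overline\gamma=(s,a)_P\cdot(t,b)_P\qquad\text{and}\qquad \gamma_\pm=(\operatorname{sign}(b)\,s,\;t)_K .$$ -/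

import Mathlib

open scoped TensorProduct

noncomputable section

namespace QuatDescent

/-! ### Continuous second cohomology of a topological group with values in a discrete
abelian group (written multiplicatively) with trivial action -/

section Cohomology

variable (G M : Type*) [Group G] [TopologicalSpace G] [CommGroup M]

/-- Continuous 2-cocycles `c : G × G → M` (`M` discrete, trivial action). -/
def cocycles2 : Subgroup (G × G → M) where
  carrier := {c | IsLocallyConstant c ∧
    ∀ g h k : G, c (g, h) * c (g * h, k) = c (h, k) * c (g, h * k)}
  one_mem' := ⟨IsLocallyConstant.const 1, fun _ _ _ => by simp⟩
  mul_mem' := by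
    rintro c c' ⟨h1, h2⟩ ⟨h1', h2'⟩
    refine ⟨h1.mul h1', fun g h k => ?_⟩
    simp only [Pi.mul_apply]
    rw [mul_mul_mul_comm, h2, h2', mul_mul_mul_comm]
  inv_mem' := by
    rintro c ⟨h1, h2⟩
    refine ⟨h1.inv, fun g h k => ?_⟩
    simp only [Pi.inv_apply]
    rw [← mul_inv, h2, mul_inv]

/-- Continuous 2-coboundaries: the cocycles `(g, h) ↦ d g * d h * (d (g h))⁻¹` with
`d : G → M` continuous. -/
def coboundaries2 : Subgroup (cocycles2 G M) where
  carrier := {c | ∃ d : G → M, IsLocallyConstant d ∧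
    ∀ g h : G, c.1 (g, h) = d g * d h * (d (g * h))⁻¹}
  one_mem' := ⟨1, IsLocallyConstant.const 1, fun _ _ => by simp⟩
  mul_mem' := by
    rintro c c' ⟨d, h1, h2⟩ ⟨d', h1', h2'⟩
    refine ⟨d * d', h1.mul h1', fun g h => ?_⟩
    simp only [Subgroup.coe_mul, Pi.mul_apply, h2, h2', mul_inv]
    simp only [mul_assoc, mul_left_comm, mul_comm]
  inv_mem' := by
    rintro c ⟨d, h1, h2⟩
    refine ⟨d⁻¹, h1.inv, fun g h => ?_⟩
    simp only [Subgroup.coe_inv, Pi.inv_apply, h2, mul_inv]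

/-- The continuous cohomology group `H²(G, M)`. -/
abbrev H2 : Type _ := cocycles2 G M ⧸ coboundaries2 G M

variable {G M}

/-- The cohomology class of a continuous 2-cocycle. -/
def H2.mk (c : cocycles2 G M) : H2 G M := QuotientGroup.mk c

/-- Push-forward of continuous 2-cocycles along `f : M → N`. -/
def cocycles2Map {N : Type*} [CommGroup N] (f : M →* N) : cocycles2 G M →* cocycles2 G N where
  toFun c := ⟨fun p => f (c.1 p), c.2.1.comp f, fun g h k => by
    rw [← map_mul, ← map_mul, c.2.2]⟩
  map_one' := by ext p; simp
  map_mul' c c' := by ext p; simp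

/-- The map `H²(G, M) → H²(G, N)` induced by `f : M → N`. -/
def H2.map {N : Type*} [CommGroup N] (f : M →* N) : H2 G M →* H2 G N :=
  QuotientGroup.map _ _ (cocycles2Map f) (by
    rintro c ⟨d, h1, h2⟩
    refine ⟨fun g => f (d g), h1.comp f, fun g h => ?_⟩
    simp only [cocycles2Map, MonoidHom.coe_mk, OneHom.coe_mk, h2, map_mul, map_inv])

/-- A 2-torsion class is `[c]` with `c(g, h)² = d g * d h * (d (g h))⁻¹`, `d` continuous. -/
theorem exists_of_sq_eq_one (γ : H2 G M) (hγ : γ ^ 2 = 1) :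
    ∃ (c : cocycles2 G M) (d : G → M), H2.mk c = γ ∧ IsLocallyConstant d ∧
      ∀ g h : G, c.1 (g, h) ^ 2 = d g * d h * (d (g * h))⁻¹ := by
  obtain ⟨c, rfl⟩ := QuotientGroup.mk_surjective γ
  rw [← QuotientGroup.mk_pow, QuotientGroup.eq_one_iff] at hγ
  obtain ⟨d, h1, h2⟩ := hγ
  exact ⟨c, d, rfl, h1, fun g h => by simpa using h2 g h⟩

end Cohomology

/-! ### The two components of a 2-torsion class in `H²(G, F^*)` -/

section Components

variable (F : Type*) [Field F]

/-- `P = F^* / {±1}`. -/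
def P : Type _ := Fˣ ⧸ Subgroup.zpowers (-1 : Fˣ)

instance : CommGroup (P F) :=
  inferInstanceAs (CommGroup (Fˣ ⧸ Subgroup.zpowers (-1 : Fˣ)))

/-- `P / P²`. -/
abbrev PModSq : Type _ := P F ⧸ (powMonoidHom 2 : P F →* P F).range

variable {F}

/-- The class in `P / P²` of an element of `F^*`. -/
def toPModSq : Fˣ →* PModSq F :=
  (QuotientGroup.mk' (powMonoidHom 2 : P F →* P F).range).comp
    (QuotientGroup.mk' (Subgroup.zpowers (-1 : Fˣ)) : Fˣ →* P F)

theorem PModSq_sq (p : PModSq F) : p ^ 2 = 1 := by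
  obtain ⟨q, rfl⟩ := QuotientGroup.mk_surjective p
  rw [← QuotientGroup.mk_pow, QuotientGroup.eq_one_iff]
  exact ⟨q, rfl⟩

/-- The sign map `F^* → {±1}` attached to a real embedding `ι` of `F`. -/
def signMap (ι : F →+* ℝ) : Fˣ →* ℤˣ where
  toFun a := if 0 < ι a then 1 else -1
  map_one' := by simp
  map_mul' a b := by
    have ha : ι a ≠ 0 := (map_ne_zero ι).2 a.ne_zero
    have hb : ι b ≠ 0 := (map_ne_zero ι).2 b.ne_zero
    rcases lt_or_gt_of_ne ha with ha | ha <;> rcases lt_or_gt_of_ne hb with hb | hb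
    · simp [mul_pos_of_neg_of_neg ha hb, ha.not_gt, hb.not_gt]
    · simp [(mul_neg_of_neg_of_pos ha hb).not_gt, ha.not_gt, hb]
    · simp [(mul_neg_of_pos_of_neg ha hb).not_gt, hb.not_gt, ha]
    · simp [mul_pos ha hb, ha, hb]

variable {G : Type*} [Group G] [TopologicalSpace G]

/-- The sign component `γ_± ∈ H²(G, {±1})`, represented by `(σ, τ) ↦ sign (c(σ, τ))`. -/
def signComponent (ι : F →+* ℝ) : H2 G Fˣ →* H2 G ℤˣ := H2.map (signMap ι)

/-- The component `γ̄ ∈ Hom(G, P/P²)` of a 2-torsion class `γ = [c]`: if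
`c(σ, τ)² = d σ * d τ * (d (σ τ))⁻¹` with `d` continuous, it sends `σ` to the class of `d σ`.
(For `G` compact and `F` real the result does not depend on the choice of `c` and `d`.) -/
def pComponent (γ : H2 G Fˣ) (hγ : γ ^ 2 = 1) : G →* PModSq F :=
  MonoidHom.mk' (fun σ => toPModSq ((exists_of_sq_eq_one γ hγ).choose_spec.choose σ)) (by
    intro σ τ
    have h := (exists_of_sq_eq_one γ hγ).choose_spec.choose_spec.2.2 σ τ
    have h' := congrArg toPModSq h
    rw [map_pow, PModSq_sq, map_mul, map_inv, map_mul] at h'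
    exact (mul_inv_eq_one.1 h'.symm).symm)

end Components

/-! ### The symbols `(t, d)_P` -/

section Symbol

/-- The absolute Galois group `G_K = Gal(K̄/K)`, with the Krull topology. -/
abbrev AbsGal (K : Type*) [Field K] : Type _ := Gal(AlgebraicClosure K/K)

variable {K F : Type*} [Field K] [Field F]

open Classical in
/-- The morphism `(t, d)_P : G_K → P/P²`: it sends `σ` to `1` if `σ` fixes the square roots of
`t`, and to the class of `d` otherwise. -/
def symbolP (t : K) (d : Fˣ) : AbsGal K →* PModSq F :=
  MonoidHom.mk' (fun σ : AbsGal K =>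
      if ∀ x : AlgebraicClosure K, x ^ 2 = algebraMap K (AlgebraicClosure K) t → σ x = x
      then 1 else toPModSq d) (by
    intro σ τ
    obtain ⟨r, hr⟩ := IsAlgClosed.exists_pow_nat_eq
      (algebraMap K (AlgebraicClosure K) t) (n := 2) (by norm_num)
    have key : ∀ ρ : AbsGal K,
        (∀ x : AlgebraicClosure K, x ^ 2 = algebraMap K (AlgebraicClosure K) t → ρ x = x) ↔
          ρ r = r := by
      intro ρ
      refine ⟨fun h => h r hr, fun h x hx => ?_⟩
      rcases sq_eq_sq_iff_eq_or_eq_neg.1 (hx.trans hr.symm) with rfl | rfl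
      · exact h
      · rw [map_neg, h]
    have sgn : ∀ ρ : AbsGal K, ρ r = r ∨ ρ r = -r := by
      intro ρ
      apply sq_eq_sq_iff_eq_or_eq_neg.1
      rw [← map_pow, hr, AlgEquiv.commutes]
    have hd : toPModSq d * toPModSq d = 1 := by rw [← sq, PModSq_sq]
    simp only [key]
    change (if σ (τ r) = r then _ else _) = _
    by_cases h0 : r = -r
    · have h : ∀ ρ : AbsGal K, ρ r = r := fun ρ => by
        rcases sgn ρ with h | h
        · exact h
        · rw [h, ← h0]
      simp [h]
    · have h0' : ¬ (-r = r) := fun h => h0 h.symm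
      rcases sgn σ with h | h <;> rcases sgn τ with h' | h' <;> simp [h, h', h0', hd])

end Symbol

/-! ### Quaternion algebras over `K` as elements of `H²(G_K, {±1})` -/

/-- The class `γ ∈ H²(G_K, {±1})` is the one identified with the quaternion algebra `A` over `K`
under `H²(G_K, {±1}) ≃ Br(K)[2] ⊆ Br(K) = H²(G_K, K̄^*)`.

The class of `A` in `H²(G_K, K̄^*)` is computed by Galois descent: if `φ : A → M₂(K̄)` is a
splitting and `x σ ∈ GL₂(K̄)`, depending continuously on `σ`, satisfies
`σ(φ(α)) = (x σ)⁻¹ φ(α) (x σ)` for all `α ∈ A`, then it is represented by the cocycle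
`(σ, τ) ↦ x σ * σ(x τ) * (x (σ τ))⁻¹ ∈ K̄^*`. Since `x σ` may be multiplied by any continuous
function `G_K → K̄^*`, the class of `c : G_K × G_K → {±1}` in `H²(G_K, K̄^*)` is that of `A` if
and only if `φ` and `x` can be chosen so that this cocycle is equal to `c`. -/
def IsQuaternionClass {K : Type*} [Field K] (A : Type*) [Ring A] [Algebra K A]
    (γ : H2 (AbsGal K) ℤˣ) : Prop :=
  ∃ c : cocycles2 (AbsGal K) ℤˣ, H2.mk c = γ ∧
    ∃ (φ : A →ₐ[K] Matrix (Fin 2) (Fin 2) (AlgebraicClosure K))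
      (x : AbsGal K → GL (Fin 2) (AlgebraicClosure K)),
      IsLocallyConstant x ∧
      (∀ (σ : AbsGal K) (α : A),
        (x σ).1 * (φ α).map σ = φ α * (x σ).1) ∧
      ∀ σ τ : AbsGal K,
        (x σ).1 * (x τ).1.map σ = ((c.1 (σ, τ) : ℤ) : AlgebraicClosure K) • (x (σ * τ)).1

/-! ### The algebra `B`, the connecting map `δ` and the sets `Δ_Q` -/

section Delta

/-- `B` is totally indefinite: `ℝ ⊗_F B ≃ M₂(ℝ)` for every real embedding of `F`. -/
def IsTotallyIndefinite (F B : Type*) [Field F] [Ring B] [Algebra F B] : Prop :=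
  ∀ φ : F →+* ℝ, letI : Algebra F ℝ := φ.toAlgebra
    Nonempty ((ℝ ⊗[F] B) ≃ₐ[ℝ] Matrix (Fin 2) (Fin 2) ℝ)

variable (F B : Type*) [Field F] [Ring B] [Algebra F B]

/-- `F^*` as a subgroup of `B^*`. -/
def scalarUnits : Subgroup Bˣ := (Units.map (algebraMap F B : F →* B)).range

instance : (scalarUnits F B).Normal where
  conj_mem := by
    rintro _ ⟨f, rfl⟩ g
    refine ⟨f, ?_⟩
    rw [eq_mul_inv_iff_mul_eq]
    ext
    exact Algebra.commutes (f : F) (g : B)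

/-- The group `B^* / F^*`. -/
abbrev ProjUnits : Type _ := Bˣ ⧸ scalarUnits F B

variable {F B} {G : Type*} [Group G]

/-- The lift `σ ↦ ψ_σ ∈ B^*` of `ψ : G → B^*/F^*`. -/
def liftFun (ψ : G →* ProjUnits F B) (σ : G) : Bˣ := (ψ σ).out

theorem lift_spec (ψ : G →* ProjUnits F B) (σ τ : G) :
    ∃ f : Fˣ, Units.map (algebraMap F B : F →* B) f =
      liftFun ψ σ * liftFun ψ τ * (liftFun ψ (σ * τ))⁻¹ := by
  have h : liftFun ψ σ * liftFun ψ τ * (liftFun ψ (σ * τ))⁻¹ ∈ scalarUnits F B := by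
    rw [← QuotientGroup.eq_one_iff]
    simp [liftFun]
  exact h

/-- The cocycle `(σ, τ) ↦ ψ_σ ψ_τ ψ_{στ}⁻¹ ∈ F^*` as a function. -/
def deltaFun (ψ : G →* ProjUnits F B) (p : G × G) : Fˣ := (lift_spec ψ p.1 p.2).choose

theorem deltaFun_spec (ψ : G →* ProjUnits F B) (σ τ : G) :
    Units.map (algebraMap F B : F →* B) (deltaFun ψ (σ, τ)) =
      liftFun ψ σ * liftFun ψ τ * (liftFun ψ (σ * τ))⁻¹ :=
  (lift_spec ψ σ τ).choose_spec

variable [TopologicalSpace G] [IsTopologicalGroup G] [Nontrivial B]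

theorem deltaFun_mem (ψ : G →* ProjUnits F B) (hψ : IsLocallyConstant ψ) :
    deltaFun ψ ∈ cocycles2 G Fˣ := by
  have inj : Function.Injective (Units.map (algebraMap F B : F →* B)) :=
    Units.map_injective (algebraMap F B).injective
  have central : ∀ (f : Fˣ) (b : Bˣ), b * Units.map (algebraMap F B : F →* B) f =
      Units.map (algebraMap F B : F →* B) f * b := fun f b => by
    ext
    exact (Algebra.commutes (f : F) (b : B)).symm
  constructor
  · have e : deltaFun ψ = (Function.invFun (Units.map (algebraMap F B : F →* B))) ∘
        fun p : G × G => liftFun ψ p.1 * liftFun ψ p.2 * (liftFun ψ (p.1 * p.2))⁻¹ := by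
      funext p
      rw [Function.comp_apply, ← deltaFun_spec, Function.leftInverse_invFun inj]
    have hl : IsLocallyConstant (liftFun ψ) := hψ.comp Quotient.out
    rw [e]
    exact IsLocallyConstant.comp (((hl.comp_continuous continuous_fst).mul
      (hl.comp_continuous continuous_snd)).mul (hl.comp_continuous continuous_mul).inv) _
  · intro g h k
    apply inj
    rw [map_mul, map_mul, deltaFun_spec ψ g h, deltaFun_spec ψ (g * h) k,
      ← central, deltaFun_spec ψ g (h * k), ← mul_assoc g h k]
    have c := central (deltaFun ψ (h, k)) (liftFun ψ g)
    rw [deltaFun_spec] at c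
    have c' : liftFun ψ g * liftFun ψ h * liftFun ψ k * (liftFun ψ (h * k))⁻¹ =
      liftFun ψ h * liftFun ψ k * (liftFun ψ (h * k))⁻¹ * liftFun ψ g := by
      rw [← c]; group
    rw [central, deltaFun_spec]
    calc _ = (liftFun ψ g * liftFun ψ h * liftFun ψ k * (liftFun ψ (h * k))⁻¹) *
          (liftFun ψ (h * k) * (liftFun ψ (g * h * k))⁻¹) := by group
      _ = _ := by rw [c']; group

/-- The connecting map `δ`: the class of `(σ, τ) ↦ ψ_σ ψ_τ ψ_{στ}⁻¹` in `H²(G, F^*)`, for a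
continuous morphism `ψ : G → B^*/F^*` (with `B^*/F^*` discrete). -/
def delta (ψ : G →* ProjUnits F B) (hψ : IsLocallyConstant ψ) : H2 G Fˣ :=
  H2.mk ⟨deltaFun ψ, deltaFun_mem ψ hψ⟩

variable (F B)

/-- `Δ_Q`: the elements of `H²(G_K, F^*)[2]` of the form `δ(ψ)` for a continuous morphism
`ψ : G_K → B^*/F^*` with image isomorphic to `Q`. -/
def Delta (K : Type*) [Field K] (Q : Type*) [Group Q] :
    Set (H2 (AbsGal K) Fˣ) :=
  {γ | γ ^ 2 = 1 ∧ ∃ (ψ : AbsGal K →* ProjUnits F B)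
    (hψ : IsLocallyConstant ψ), Nonempty (ψ.range ≃* Q) ∧ γ = delta ψ hψ}

end Delta

/-- The cyclic group of order `n`, written multiplicatively. -/
abbrev C (n : ℕ) : Type := Multiplicative (ZMod n)

end QuatDescent

end

/-! A Klein four-subgroup of `B^*/F^*` is generated by classes of `α`, `β` with `α² = a` and `β² =
b` in `F^*`. Commutation in the quotient gives `αβ = ±βα`; the sign `+` would make `α` central, so
`α`, `β` anticommute and `B ≃ (a, b)_F` (`exists_anticommuting_lifts`). By Kummer theory, a morphism
onto this subgroup amounts to two quadratic characters `e`, `f`, those of `√s` and `√t`, with none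
of `s`, `t`, `st` a square.

The lift `σ ↦ β^f(σ) α^e(σ)` has cocycle `(-1)^(e∪f) · a^(e∪e) · b^(f∪f)`, the exponents being
products of the 0/1 values of the characters; this is `symbolCocycle`. Its square is the coboundary
of `a^e b^f`, so the component in `P/P²` is `(s, a)_P (t, b)_P`. Total indefiniteness excludes that
`a` and `b` are both negative, so `a > 0` after a possible swap. The sign component is then
`(-1)^(e∪f) · sign(b)^(f∪f)`, and since `(t, t) = (-1, t)` it is the class of `(sign(b) s, t)_K`.
The latter is `isQuaternionClass_iff`: an explicit descent datum, its uniqueness up to scalars, and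
Hilbert 90.

Conversely, such `s, t, a, b` define a `ψ` for which `δ(ψ)` has the same two components as `γ`. The
components determine a 2-torsion class (`eq_of_components`), because in a field with a real
embedding only `±1` satisfy `x² = ±1`. -/

noncomputable section

namespace QuatDescent

/-! ### Hilbert 90 and quadratic Kummer theory -/

section Galois

variable {K : Type*} [Field K]

local notation "K̄" => AlgebraicClosure K

theorem isLocallyConstant_apply (z : K̄) : IsLocallyConstant fun σ : AbsGal K => σ z := by
  rw [IsLocallyConstant.iff_exists_open]
  intro σ
  refine ⟨(fun τ => σ⁻¹ * τ) ⁻¹' (MulAction.stabilizer (AbsGal K) z),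
    (stabilizer_isOpen_of_isIntegral z).preimage (continuous_const_mul _), by simp, ?_⟩
  intro τ hτ
  have h : σ⁻¹ (τ z) = z := hτ
  exact (AlgEquiv.apply_symm_apply σ (τ z)).symm.trans (congrArg σ h)

/-- Hilbert 90 for locally constant 1-cocycles of the absolute Galois group. -/
theorem exists_eq_div_of_isCocycle (l : AbsGal K → K̄) (hl : IsLocallyConstant l)
    (h0 : ∀ σ, l σ ≠ 0) (hc : ∀ σ τ, l (σ * τ) = l σ * σ (l τ)) :
    ∃ m : K̄, m ≠ 0 ∧ ∀ σ, σ m = l σ * m := by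
  have h1 : l 1 = 1 := by
    have := hc 1 1
    rw [mul_one, AlgEquiv.one_apply] at this
    exact (mul_eq_left₀ (h0 1)).1 this.symm
  have hn : {σ | l σ = 1} ∈ nhds (1 : AbsGal K) :=
    (hl.isOpen_fiber 1).mem_nhds h1
  obtain ⟨E, hE, hE'⟩ := (krullTopology_mem_nhds_one_iff K K̄ _).1 hn
  -- The cocycle is trivial on the subgroup fixing the finite extension `E`, so its values depend
  -- only on restrictions to `E`.
  have hwd : ∀ σ τ : AbsGal K, (∀ x : E, σ x = τ x) → l σ = l τ := by
    intro σ τ h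
    have : l (τ⁻¹ * σ) = 1 := by
      refine hE' ?_
      rw [SetLike.mem_coe, IntermediateField.mem_fixingSubgroup_iff]
      intro x hx
      change τ.symm (σ x) = x
      rw [h ⟨x, hx⟩, AlgEquiv.symm_apply_apply]
    have h2 := hc τ (τ⁻¹ * σ)
    rwa [mul_inv_cancel_left, this, map_one, mul_one] at h2
  -- `E` need not be normal, so the averaging runs over the embeddings of `E` in `K̄`. Each is
  -- extended to `K̄`; by `hwd` the extension chosen is immaterial.
  have hext : ∀ j : E →ₐ[K] K̄, ∃ σ : AbsGal K, ∀ x : E, σ x = j x := by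
    intro j
    obtain ⟨φ, hφ⟩ := IsAlgClosed.surjective_domRestrict_of_isAlgebraic
      (K := K) (L := E) (M := K̄) (E := K̄) j
    refine ⟨(Algebra.IsAlgebraic.algEquivEquivAlgHom K K̄).symm φ, fun x => ?_⟩
    have := congrArg (fun f => f x) hφ
    exact this
  choose L hL using hext
  have hind := (linearIndependent_monoidHom E K̄).comp
    (fun j : E →ₐ[K] K̄ => (j : E →* K̄)) (fun j j' h => by
      ext x
      exact DFunLike.congr_fun h x)
  rw [Fintype.linearIndependent_iff] at hind
  have hne : ∃ x : E, ∑ j : E →ₐ[K] K̄, l (L j) * j x ≠ 0 := by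
    by_contra! h
    -- Otherwise Dedekind's independence of characters would make a value of `l` vanish.
    refine h0 _ (hind (fun j => l (L j)) ?_ E.val)
    funext x
    simpa using h x
  obtain ⟨x, hx⟩ := hne
  -- The sum `S` satisfies `S = l σ * σ S`, because composition with `σ` permutes the embeddings;
  -- hence the inverse.
  refine ⟨(∑ j : E →ₐ[K] K̄, l (L j) * j x)⁻¹, inv_ne_zero hx, fun σ => ?_⟩
  have key : ∑ j : E →ₐ[K] K̄, l (L j) * j x =
      l σ * σ (∑ j : E →ₐ[K] K̄, l (L j) * j x) := by
    rw [map_sum, Finset.mul_sum]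
    symm
    refine Fintype.sum_equiv
      ⟨fun j => (σ : K̄ →ₐ[K] K̄).comp j, fun j => (σ.symm : K̄ →ₐ[K] K̄).comp j,
        fun j => by ext; simp, fun j => by ext; simp⟩ _ _ fun j => ?_
    rw [map_mul, ← mul_assoc, ← hc]
    change _ = l (L _) * σ (j x)
    congr 1
    refine hwd _ _ fun y => ?_
    rw [hL]
    exact congrArg σ (hL j y)
  rw [map_inv₀]
  have hσ : σ (∑ j : E →ₐ[K] K̄, l (L j) * j x) ≠ 0 :=
    (map_ne_zero σ).2 hx
  rw [inv_eq_iff_eq_inv, mul_inv, inv_inv]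
  conv_rhs => rw [key]
  field_simp [h0 σ]

/-- The character `e` describes the action of the Galois group on the square root `r`. -/
def IsSqrtChar (r : K̄) (e : AbsGal K →* ℤˣ) : Prop :=
  ∀ σ : AbsGal K, σ r = ((e σ : ℤ) : K̄) * r

theorem IsSqrtChar.mul {r r' : K̄} {e e' : AbsGal K →* ℤˣ} (h : IsSqrtChar r e)
    (h' : IsSqrtChar r' e') : IsSqrtChar (r * r') (e * e') := fun σ => by
  rw [map_mul, h σ, h' σ, MonoidHom.mul_apply]
  push_cast
  ring

variable [CharZero K]

theorem intUnits_cast_injective : Function.Injective fun u : ℤˣ => ((u : ℤ) : K̄) :=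
  fun _ _ h => Units.ext (Int.cast_injective h)

theorem intUnits_cast_ne_zero (u : ℤˣ) : ((u : ℤ) : K̄) ≠ 0 := by
  rcases Int.units_eq_one_or u with rfl | rfl <;> simp

theorem IsSqrtChar.isLocallyConstant {r : K̄} {e : AbsGal K →* ℤˣ} (h : IsSqrtChar r e)
    (hr : r ≠ 0) : IsLocallyConstant e := by
  have h' := (isLocallyConstant_apply r).comp (· / r)
  refine IsLocallyConstant.desc e (fun u : ℤˣ => ((u : ℤ) : K̄)) ?_ intUnits_cast_injective
  convert h' using 1
  funext σ
  simp [h σ, hr]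

theorem exists_isSqrtChar (t : K) (ht : t ≠ 0) :
    ∃ (r : K̄) (e : AbsGal K →* ℤˣ), r ^ 2 = algebraMap K K̄ t ∧ r ≠ 0 ∧ IsSqrtChar r e ∧
      IsLocallyConstant e := by
  obtain ⟨r, hr⟩ := IsAlgClosed.exists_pow_nat_eq (algebraMap K K̄ t) (n := 2) (by norm_num)
  have hr0 : r ≠ 0 := by
    rintro rfl
    simp at hr
    exact ht ((map_eq_zero_iff _ (algebraMap K K̄).injective).1 hr.symm)
  have sgn : ∀ σ : AbsGal K, ∃ u : ℤˣ, σ r = ((u : ℤ) : K̄) * r := by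
    intro σ
    have : σ r = r ∨ σ r = -r := by
      apply sq_eq_sq_iff_eq_or_eq_neg.1
      rw [← map_pow, hr, AlgEquiv.commutes]
    rcases this with h | h
    · exact ⟨1, by simp [h]⟩
    · exact ⟨-1, by simp [h]⟩
  choose e he using sgn
  let e' : AbsGal K →* ℤˣ := MonoidHom.mk' e fun σ τ => by
    apply intUnits_cast_injective (K := K)
    apply mul_right_cancel₀ hr0
    change _ = (((e σ * e τ : ℤˣ) : ℤ) : K̄) * r
    rw [← he, AlgEquiv.mul_apply, he τ, map_mul, map_intCast, he σ]
    push_cast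
    ring
  have h : IsSqrtChar r e' := he
  exact ⟨r, e', hr, hr0, h, h.isLocallyConstant hr0⟩

/-- Kummer theory for quadratic characters. -/
theorem exists_sqrt_of_char (e : AbsGal K →* ℤˣ) (he : IsLocallyConstant e) :
    ∃ (r : K̄) (t : K), r ^ 2 = algebraMap K K̄ t ∧ r ≠ 0 ∧ IsSqrtChar r e := by
  obtain ⟨r, hr, h⟩ := exists_eq_div_of_isCocycle (fun σ => ((e σ : ℤ) : K̄))
    (he.comp fun u : ℤˣ => ((u : ℤ) : K̄)) (fun σ => intUnits_cast_ne_zero _)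
    (fun σ τ => by simp)
  have hfix : ∀ σ : AbsGal K, σ (r ^ 2) = r ^ 2 := by
    intro σ
    rw [map_pow, h σ]
    rcases Int.units_eq_one_or (e σ) with h | h <;> simp [h]
  obtain ⟨t, ht⟩ := (InfiniteGalois.mem_range_algebraMap_iff_fixed (r ^ 2)).2 hfix
  exact ⟨r, t, ht.symm, hr, h⟩

theorem IsSqrtChar.isSquare_iff {r : K̄} {e : AbsGal K →* ℤˣ} (h : IsSqrtChar r e)
    (hr : r ≠ 0) {t : K} (ht : r ^ 2 = algebraMap K K̄ t) : IsSquare t ↔ ∀ σ, e σ = 1 := by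
  have hfix : (∀ σ, e σ = 1) ↔ ∀ σ : AbsGal K, σ r = r := by
    refine forall_congr' fun σ => ?_
    rw [h σ, mul_eq_right₀ hr]
    exact ⟨fun h => by simp [h], fun h => intUnits_cast_injective (K := K) (by simpa using h)⟩
  rw [hfix, ← InfiniteGalois.mem_range_algebraMap_iff_fixed]
  constructor
  · rintro ⟨y, rfl⟩
    rw [map_mul, ← sq] at ht
    rcases sq_eq_sq_iff_eq_or_eq_neg.1 ht with h | h
    · exact ⟨y, h.symm⟩
    · exact ⟨-y, by rw [map_neg, h]⟩
  · rintro ⟨y, rfl⟩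
    rw [← map_pow] at ht
    exact ⟨y, by rw [← sq]; exact ((algebraMap K K̄).injective ht).symm⟩

theorem IsSqrtChar.symbolP_apply {F : Type*} [Field F] {r : K̄} {e : AbsGal K →* ℤˣ}
    (h : IsSqrtChar r e) (hr : r ≠ 0) {t : K} (ht : r ^ 2 = algebraMap K K̄ t) (d : Fˣ)
    (σ : AbsGal K) : symbolP t d σ = if e σ = -1 then toPModSq d else 1 := by
  classical
  have key : (∀ x : K̄, x ^ 2 = algebraMap K K̄ t → σ x = x) ↔ e σ = 1 := by
    constructor
    · intro H
      have := H r ht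
      rw [h σ, mul_eq_right₀ hr] at this
      exact intUnits_cast_injective (K := K) (by simpa using this)
    · intro H x hx
      have hσ : σ r = r := by rw [h σ, H]; simp
      rcases sq_eq_sq_iff_eq_or_eq_neg.1 (hx.trans ht.symm) with rfl | rfl
      · exact hσ
      · rw [map_neg, hσ]
  change (if _ then _ else _) = _
  rw [if_congr key rfl rfl]
  rcases Int.units_eq_one_or (e σ) with h | h <;> simp [h]

end Galois

/-! ### The explicit cocycle attached to two quadratic characters -/

section Cup

variable {G M : Type*} [Group G] [CommGroup M]

/-- The function `(g, h) ↦ m` if `e g = f h = -1`, and `1` otherwise. -/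
def cupFun (m : M) (e f : G →* ℤˣ) (p : G × G) : M :=
  if e p.1 = -1 ∧ f p.2 = -1 then m else 1

theorem map_cupFun {N : Type*} [CommGroup N] (φ : M →* N) (m : M) (e f : G →* ℤˣ) (p : G × G) :
    φ (cupFun m e f p) = cupFun (φ m) e f p := by
  unfold cupFun
  split_ifs <;> simp

variable [TopologicalSpace G]

theorem H2.mk_eq_mk_iff {c c' : cocycles2 G M} : H2.mk c = H2.mk c' ↔
    ∃ d : G → M, IsLocallyConstant d ∧
      ∀ g h : G, c.1 (g, h) = c'.1 (g, h) * (d g * d h * (d (g * h))⁻¹) := by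
  rw [eq_comm]
  refine QuotientGroup.eq.trans (exists_congr fun d => and_congr_right fun _ =>
    forall₂_congr fun g h => ?_)
  simp only [Subgroup.coe_mul, Subgroup.coe_inv, Pi.mul_apply, Pi.inv_apply]
  rw [inv_mul_eq_iff_eq_mul]

theorem isLocallyConstant_cupFun (m : M) {e f : G →* ℤˣ} (he : IsLocallyConstant e)
    (hf : IsLocallyConstant f) : IsLocallyConstant (cupFun m e f) :=
  ((he.comp_continuous continuous_fst).prodMk (hf.comp_continuous continuous_snd)).comp
    fun q : ℤˣ × ℤˣ => if q.1 = -1 ∧ q.2 = -1 then m else 1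

theorem cupFun_mem {z : M} (hz : z ^ 2 = 1) {e f : G →* ℤˣ} (he : IsLocallyConstant e)
    (hf : IsLocallyConstant f) : cupFun z e f ∈ cocycles2 G M := by
  refine ⟨isLocallyConstant_cupFun z he hf, fun g h k => ?_⟩
  have hz' : z * z = 1 := by rw [← sq, hz]
  simp only [cupFun, map_mul]
  rcases Int.units_eq_one_or (e g) with h1 | h1 <;>
  rcases Int.units_eq_one_or (e h) with h2 | h2 <;>
  rcases Int.units_eq_one_or (f h) with h3 | h3 <;>
  rcases Int.units_eq_one_or (f k) with h4 | h4 <;>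
  simp [h1, h2, h3, h4, hz']

/-- Unlike in `cupFun_mem`, `m` is arbitrary: this is the carry cocycle of the extension of `{±1}`
obtained by adjoining a square root of `m`, pulled back along `e`. -/
theorem cupFun_self_mem (m : M) {e : G →* ℤˣ} (he : IsLocallyConstant e) :
    cupFun m e e ∈ cocycles2 G M := by
  refine ⟨isLocallyConstant_cupFun m he he, fun g h k => ?_⟩
  simp only [cupFun, map_mul]
  rcases Int.units_eq_one_or (e g) with h1 | h1 <;>
  rcases Int.units_eq_one_or (e h) with h2 | h2 <;>
  rcases Int.units_eq_one_or (e k) with h4 | h4 <;>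
  simp [h1, h2, h4]

/-- The cocycle of the lift `σ ↦ β^f(σ) α^e(σ)`, where `α² = a`, `β² = b`, `αβ = zβα`. -/
def symbolCocycle (a b : M) {z : M} (hz : z ^ 2 = 1) {e f : G →* ℤˣ}
    (he : IsLocallyConstant e) (hf : IsLocallyConstant f) : cocycles2 G M :=
  ⟨cupFun z e f, cupFun_mem hz he hf⟩ * ⟨cupFun a e e, cupFun_self_mem a he⟩ *
    ⟨cupFun b f f, cupFun_self_mem b hf⟩

theorem symbolCocycle_apply (a b : M) {z : M} (hz : z ^ 2 = 1) {e f : G →* ℤˣ}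
    (he : IsLocallyConstant e) (hf : IsLocallyConstant f) (p : G × G) :
    (symbolCocycle a b hz he hf).1 p = cupFun z e f p * cupFun a e e p * cupFun b f f p := rfl

theorem H2.map_mk_symbolCocycle {N : Type*} [CommGroup N] (φ : M →* N) (a b : M) {z : M}
    (hz : z ^ 2 = 1) (hz' : (φ z) ^ 2 = 1) {e f : G →* ℤˣ}
    (he : IsLocallyConstant e) (hf : IsLocallyConstant f) :
    H2.map φ (H2.mk (symbolCocycle a b hz he hf)) =
      H2.mk (symbolCocycle (φ a) (φ b) hz' he hf) := by
  change H2.mk (cocycles2Map φ _) = _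
  congr 1
  ext p
  change φ (_ * _ * _) = _ * _ * _
  simp only [map_mul, map_cupFun]

end Cup

/-! ### Splittings of a quaternion algebra over `K̄` -/

section QuaternionClass

variable {K : Type*} [Field K]

local notation "K̄" => AlgebraicClosure K

open Matrix

theorem isLocallyConstant_generalLinearGroup_map (p : GL (Fin 2) K̄) :
    IsLocallyConstant fun σ : AbsGal K =>
      Matrix.GeneralLinearGroup.map (n := Fin 2) ((σ : K̄ →ₐ[K] K̄) : K̄ →+* K̄) p := by
  refine IsLocallyConstant.desc _
    (fun g : GL (Fin 2) K̄ => (g.1 0 0, g.1 0 1, g.1 1 0, g.1 1 1))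
    ((isLocallyConstant_apply (p.1 0 0)).prodMk ((isLocallyConstant_apply (p.1 0 1)).prodMk
      ((isLocallyConstant_apply (p.1 1 0)).prodMk (isLocallyConstant_apply (p.1 1 1))))) ?_
  intro g h hgh
  simp only [Prod.mk.injEq] at hgh
  ext i j
  fin_cases i <;> fin_cases j
  exacts [hgh.1, hgh.2.1, hgh.2.2.1, hgh.2.2.2]

/-- `diag(u, -u)` as an invertible matrix. -/
def diagUnit {u : K̄} (hu : u ≠ 0) : GL (Fin 2) K̄ :=
  ⟨!![u, 0; 0, -u], !![u⁻¹, 0; 0, -u⁻¹], by simp [hu, Matrix.one_fin_two],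
    by simp [hu, Matrix.one_fin_two]⟩

/-- The antidiagonal matrix with both entries `v` as an invertible matrix. -/
def antidiagUnit {v : K̄} (hv : v ≠ 0) : GL (Fin 2) K̄ :=
  ⟨!![0, v; v, 0], !![0, v⁻¹; v⁻¹, 0], by simp [hv, Matrix.one_fin_two],
    by simp [hv, Matrix.one_fin_two]⟩

/-- The standard splitting of a quaternion algebra over the algebraic closure. -/
def splitting {a b : K} {u v : K̄} (hu : u ^ 2 = algebraMap K K̄ a)
    (hv : v ^ 2 = algebraMap K K̄ b) :
    QuaternionAlgebra K a 0 b →ₐ[K] Matrix (Fin 2) (Fin 2) K̄ :=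
  QuaternionAlgebra.Basis.liftHom
    { i := !![u, 0; 0, -u]
      j := !![0, v; v, 0]
      k := !![0, u * v; -(u * v), 0]
      i_mul_i := by
        ext i j
        fin_cases i <;> fin_cases j <;> simp [Algebra.smul_def (A := K̄), ← hu, sq]
      j_mul_j := by
        ext i j
        fin_cases i <;> fin_cases j <;> simp [Algebra.smul_def (A := K̄), ← hv, sq]
      i_mul_j := by
        ext i j
        fin_cases i <;> fin_cases j <;> simp
      j_mul_i := by
        ext i j
        fin_cases i <;> fin_cases j <;> simp [mul_comm] }

theorem splitting_apply {a b : K} {u v : K̄} (hu : u ^ 2 = algebraMap K K̄ a)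
    (hv : v ^ 2 = algebraMap K K̄ b) (α : QuaternionAlgebra K a 0 b) :
    splitting hu hv α =
      !![algebraMap K K̄ α.re + algebraMap K K̄ α.imI * u,
          algebraMap K K̄ α.imJ * v + algebraMap K K̄ α.imK * (u * v);
        algebraMap K K̄ α.imJ * v - algebraMap K K̄ α.imK * (u * v),
          algebraMap K K̄ α.re - algebraMap K K̄ α.imI * u] := by
  ext i j
  fin_cases i <;> fin_cases j <;>
    simp [splitting, QuaternionAlgebra.Basis.lift, Algebra.smul_def (A := K̄), Matrix.algebraMap_matrix_apply,
      sub_eq_add_neg]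

variable [CharZero K]

/-- Two splittings of a quaternion algebra are conjugate. -/
theorem exists_conj_splitting {a b : K} {u v : K̄} (hu : u ^ 2 = algebraMap K K̄ a)
    (hv : v ^ 2 = algebraMap K K̄ b) (hu0 : u ≠ 0) (hv0 : v ≠ 0)
    (φ : QuaternionAlgebra K a 0 b →ₐ[K] Matrix (Fin 2) (Fin 2) K̄) :
    ∃ p : GL (Fin 2) K̄, φ ⟨0, 1, 0, 0⟩ * p.1 = p.1 * (diagUnit hu0).1 ∧
      φ ⟨0, 0, 1, 0⟩ * p.1 = p.1 * (antidiagUnit hv0).1 := by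
  set I := φ ⟨0, 1, 0, 0⟩ with hI
  set J := φ ⟨0, 0, 1, 0⟩ with hJ
  have hII : I * I = (u * u) • 1 := by
    rw [hI, ← sq u, ← map_mul, hu, ← Algebra.algebraMap_eq_smul_one (R := K̄),
      ← IsScalarTower.algebraMap_apply K K̄ (Matrix (Fin 2) (Fin 2) K̄), ← φ.commutes]
    congr 1
    ext <;> simp
  have hJJ : J * J = (v * v) • 1 := by
    rw [hJ, ← sq v, ← map_mul, hv, ← Algebra.algebraMap_eq_smul_one (R := K̄),
      ← IsScalarTower.algebraMap_apply K K̄ (Matrix (Fin 2) (Fin 2) K̄), ← φ.commutes]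
    congr 1
    ext <;> simp
  have hIJ : I * J = -(J * I) := by
    rw [hI, hJ, ← map_mul, ← map_mul, ← map_neg]
    congr 1
    ext <;> simp
  -- If `I = -u` were scalar, it would both commute and anticommute with `J`, forcing `J = 0`.
  have hne : I + u • 1 ≠ 0 := by
    intro h
    have h1 : I = -(u • 1) := eq_neg_of_add_eq_zero_left h
    rw [h1] at hIJ
    simp only [neg_mul, mul_neg, smul_mul_assoc, mul_smul_comm, one_mul, mul_one, neg_neg] at hIJ
    have h2 : (2 * u) • J = 0 := by
      rw [mul_smul, two_smul]
      nth_rewrite 1 [← hIJ]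
      simp
    have h3 : J = 0 := (smul_eq_zero.1 h2).resolve_left (by simp [hu0])
    rw [h3, mul_zero] at hJJ
    have := congrFun (congrFun hJJ 0) 0
    simp [hv0] at this
  obtain ⟨k, hk⟩ : ∃ k, (fun i => (I + u • 1) i k) ≠ 0 := by
    by_contra! h
    exact hne (by ext i k; exact congrFun (h k) i)
  -- Since `(I - u)(I + u) = 0`, a nonzero column of `I + u` is an eigenvector of `I` for `u`. As
  -- `J` anticommutes with `I`, it sends `w` into the eigenspace for `-u`; in the basis `w, v⁻¹Jw`
  -- both matrices take their standard form.
  set w : Fin 2 → K̄ := fun i => (I + u • 1) i k with hw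
  have hIw : I *ᵥ w = u • w := by
    have : (I * (I + u • 1)) = u • (I + u • 1) := by
      rw [mul_add, hII, mul_smul_comm, mul_one, smul_add, smul_smul, add_comm]
    funext i
    exact congrFun (congrFun this i) k
  set w' : Fin 2 → K̄ := v⁻¹ • (J *ᵥ w) with hw'
  have hJw : J *ᵥ w = v • w' := by rw [hw', smul_smul, mul_inv_cancel₀ hv0, one_smul]
  have hJw' : J *ᵥ w' = v • w := by
    rw [hw', Matrix.mulVec_smul, Matrix.mulVec_mulVec, hJJ, Matrix.smul_mulVec, one_mulVec,
      smul_smul]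
    congr 1
    field_simp
  have hIw' : I *ᵥ w' = -(u • w') := by
    rw [hw', Matrix.mulVec_smul, Matrix.mulVec_mulVec, hIJ, Matrix.neg_mulVec,
      ← Matrix.mulVec_mulVec, hIw, Matrix.mulVec_smul, smul_neg, smul_comm]
  let p : Matrix (Fin 2) (Fin 2) K̄ := Matrix.of fun i j => ![w i, w' i] j
  have hIp : I * p = p * (diagUnit hu0).1 := by
    ext i j
    have h1 := congrFun hIw i
    have h2 := congrFun hIw' i
    simp only [mulVec, dotProduct, Fin.sum_univ_two, Pi.smul_apply, Pi.neg_apply,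
      smul_eq_mul] at h1 h2
    fin_cases j <;>
      simp [p, diagUnit, Matrix.mul_apply, Fin.sum_univ_two, h1, h2, mul_comm]
  have hJp : J * p = p * (antidiagUnit hv0).1 := by
    ext i j
    have h1 := congrFun hJw i
    have h2 := congrFun hJw' i
    simp only [mulVec, dotProduct, Fin.sum_univ_two, Pi.smul_apply,
      smul_eq_mul] at h1 h2
    fin_cases j <;>
      simp [p, antidiagUnit, Matrix.mul_apply, Fin.sum_univ_two, h1, h2, mul_comm]
  have hdet : p.det ≠ 0 := by
    intro h0
    obtain ⟨y, hy, hpy⟩ := Matrix.exists_mulVec_eq_zero_iff.2 h0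
    have e1 : ∀ i, w i * y 0 + w' i * y 1 = 0 := fun i => by
      simpa [p, mulVec, dotProduct, Fin.sum_univ_two] using congrFun hpy i
    -- Applying `I` to the relation `e1` flips the sign of its second term, since the eigenvalues
    -- are `u` and `-u`.
    have e2 : ∀ i, w i * y 0 - w' i * y 1 = 0 := fun i => by
      have h1 : p *ᵥ ((diagUnit hu0).1 *ᵥ y) = 0 := by
        rw [Matrix.mulVec_mulVec, ← hIp, ← Matrix.mulVec_mulVec, hpy, Matrix.mulVec_zero]
      have h2 := congrFun h1 i
      simp [p, diagUnit, mulVec, dotProduct, Fin.sum_univ_two] at h2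
      have h3 : u * (w i * y 0 - w' i * y 1) = 0 := by linear_combination h2
      exact (mul_eq_zero.1 h3).resolve_left hu0
    have f1 : ∀ i, w i * y 0 = 0 := fun i => by linear_combination (e1 i + e2 i) / 2
    have f2 : ∀ i, w' i * y 1 = 0 := fun i => by linear_combination (e1 i - e2 i) / 2
    have hy0 : y 0 = 0 := by
      by_contra h
      exact hk (funext fun i => (mul_eq_zero.1 (f1 i)).resolve_right h)
    have hy1 : y 1 = 0 := by
      by_contra h
      have hw0 : w' = 0 := funext fun i => (mul_eq_zero.1 (f2 i)).resolve_right h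
      rw [hw0, Matrix.mulVec_zero] at hJw'
      exact hk ((smul_eq_zero.1 hJw'.symm).resolve_left hv0)
    exact hy (by funext i; fin_cases i <;> assumption)
  exact ⟨Matrix.GeneralLinearGroup.mkOfDetNeZero p hdet, hIp, hJp⟩

end QuaternionClass

/-! ### The Galois descent datum of a quaternion algebra and its class -/

section QuaternionClass

variable {K : Type*} [Field K]

local notation "K̄" => AlgebraicClosure K

open Matrix

/-- A scalar cochain which makes `cupFun (-1) m f` and `cupFun ε f f` cohomologous, where `m` is
the character of `√ε`. -/
def scalarCochain {I : K̄} (hI : I ≠ 0) (x : ℤˣ) : K̄ˣ := if x = -1 then Units.mk0 I hI else 1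

theorem scalarCochain_mul {I : K̄} (hI : I ≠ 0) {m : AbsGal K →* ℤˣ} {ε : ℤˣ}
    (hI2 : I ^ 2 = ((ε : ℤ) : K̄)) (hm : IsSqrtChar I m) (σ : AbsGal K) (x y : ℤˣ) :
    (scalarCochain hI x : K̄) * σ (scalarCochain hI y) =
      (((if m σ = -1 ∧ y = -1 then -1 else 1 : ℤˣ) : ℤ) : K̄) *
      (((if x = -1 ∧ y = -1 then ε else 1 : ℤˣ) : ℤ) : K̄) * scalarCochain hI (x * y) := by
  have hmσ := hm σ
  rcases Int.units_eq_one_or (m σ) with h2 | h2 <;>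
  rcases Int.units_eq_one_or x with rfl | rfl <;>
  rcases Int.units_eq_one_or y with rfl | rfl <;>
  · rw [h2] at hmσ ⊢
    simp [scalarCochain, hmσ, ← hI2, sq]

theorem splitting_i {a b : K} {u v : K̄} (hu : u ^ 2 = algebraMap K K̄ a)
    (hv : v ^ 2 = algebraMap K K̄ b) (hu0 : u ≠ 0) :
    splitting hu hv ⟨0, 1, 0, 0⟩ = (diagUnit hu0).1 := by
  simp [splitting_apply, diagUnit]

theorem splitting_j {a b : K} {u v : K̄} (hu : u ^ 2 = algebraMap K K̄ a)
    (hv : v ^ 2 = algebraMap K K̄ b) (hv0 : v ≠ 0) :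
    splitting hu hv ⟨0, 0, 1, 0⟩ = (antidiagUnit hv0).1 := by
  simp [splitting_apply, antidiagUnit]

variable [CharZero K]

/-- The matrix `diag(1, -1)^x antidiag(1, 1)^y`. -/
def kleinMatrix (x y : ℤˣ) : GL (Fin 2) K̄ :=
  (if x = -1 then diagUnit (one_ne_zero (α := K̄)) else 1) *
    (if y = -1 then antidiagUnit (one_ne_zero (α := K̄)) else 1)

theorem kleinMatrix_map (σ : AbsGal K) (x y : ℤˣ) :
    (kleinMatrix (K := K) x y).1.map σ = (kleinMatrix x y).1 := by
  rcases Int.units_eq_one_or x with rfl | rfl <;>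
  rcases Int.units_eq_one_or y with rfl | rfl <;>
  · ext i j
    fin_cases i <;> fin_cases j <;> simp [kleinMatrix, diagUnit, antidiagUnit]

theorem kleinMatrix_mul (x y x' y' : ℤˣ) :
    (kleinMatrix (K := K) x y).1 * (kleinMatrix x' y').1 =
      (((if y = -1 ∧ x' = -1 then -1 else 1 : ℤˣ) : ℤ) : K̄) •
        (kleinMatrix (x * x') (y * y')).1 := by
  rcases Int.units_eq_one_or x with rfl | rfl <;>
  rcases Int.units_eq_one_or y with rfl | rfl <;>
  rcases Int.units_eq_one_or x' with rfl | rfl <;>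
  rcases Int.units_eq_one_or y' with rfl | rfl <;>
  · ext i j
    fin_cases i <;> fin_cases j <;> simp [kleinMatrix, diagUnit, antidiagUnit]

/-- Conjugation by `antidiag(1, 1)` negates the image of `i` and fixes that of `j`, while `diag(1,
-1)` does the opposite. Hence the character of `√b` governs the diagonal factor and that of `√a` the
antidiagonal one. -/
theorem kleinMatrix_comm {u v : K̄} {p f : AbsGal K →* ℤˣ} {a b : K}
    (hu : u ^ 2 = algebraMap K K̄ a) (hv : v ^ 2 = algebraMap K K̄ b)
    (hp : IsSqrtChar u p) (hf : IsSqrtChar v f) (σ : AbsGal K)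
    (α : QuaternionAlgebra K a 0 b) :
    (kleinMatrix (f σ) (p σ)).1 * (splitting hu hv α).map σ =
      splitting hu hv α * (kleinMatrix (f σ) (p σ)).1 := by
  rw [splitting_apply, kleinMatrix]
  have h1 := hp σ
  have h2 := hf σ
  rcases Int.units_eq_one_or (p σ) with hp | hp <;>
  rcases Int.units_eq_one_or (f σ) with hf | hf <;>
  · rw [hp] at h1 ⊢
    rw [hf] at h2 ⊢
    simp only [Units.val_one, Units.val_neg, Int.cast_one, Int.cast_neg, one_mul, neg_mul]
      at h1 h2
    ext i j
    fin_cases i <;> fin_cases j <;>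
      simp [diagUnit, antidiagUnit, Matrix.mul_apply, Fin.sum_univ_two, h1, h2,
        sub_eq_add_neg] <;> ring

/-- The lift to `GL₂` of the descent datum of a quaternion algebra. -/
def descentMap {I : K̄} (hI : I ≠ 0) (p f : AbsGal K →* ℤˣ) (σ : AbsGal K) : GL (Fin 2) K̄ :=
  Matrix.GeneralLinearGroup.scalar (Fin 2) (scalarCochain hI (f σ)) * kleinMatrix (f σ) (p σ)

theorem descentMap_val {I : K̄} (hI : I ≠ 0) (p f : AbsGal K →* ℤˣ) (σ : AbsGal K) :
    (descentMap hI p f σ).1 =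
      (scalarCochain hI (f σ) : K̄) • (kleinMatrix (f σ) (p σ)).1 := by
  simp [descentMap, Matrix.smul_eq_diagonal_mul, Matrix.scalar_apply]

theorem isLocallyConstant_descentMap {I : K̄} (hI : I ≠ 0) {p f : AbsGal K →* ℤˣ}
    (hp : IsLocallyConstant p) (hf : IsLocallyConstant f) :
    IsLocallyConstant (descentMap hI p f) :=
  (hf.prodMk hp).comp fun q : ℤˣ × ℤˣ =>
    Matrix.GeneralLinearGroup.scalar (Fin 2) (scalarCochain hI q.1) * kleinMatrix q.1 q.2

theorem descentMap_comm {I u v : K̄} (hI : I ≠ 0) {p f : AbsGal K →* ℤˣ} {a b : K}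
    (hu : u ^ 2 = algebraMap K K̄ a) (hv : v ^ 2 = algebraMap K K̄ b)
    (hp : IsSqrtChar u p) (hf : IsSqrtChar v f) (σ : AbsGal K)
    (α : QuaternionAlgebra K a 0 b) :
    (descentMap hI p f σ).1 * (splitting hu hv α).map σ =
      splitting hu hv α * (descentMap hI p f σ).1 := by
  rw [descentMap_val, smul_mul_assoc, kleinMatrix_comm hu hv hp hf, mul_smul_comm]

theorem descentMap_mul {I : K̄} (hI : I ≠ 0) {e m f : AbsGal K →* ℤˣ} {ε : ℤˣ}
    (hI2 : I ^ 2 = ((ε : ℤ) : K̄)) (hm : IsSqrtChar I m) (σ τ : AbsGal K) :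
    (descentMap hI (e * m) f σ).1 * (descentMap hI (e * m) f τ).1.map σ =
      (((cupFun (-1) e f (σ, τ) * cupFun ε f f (σ, τ) : ℤˣ) : ℤ) : K̄) •
        (descentMap hI (e * m) f (σ * τ)).1 := by
  have hmap : ((scalarCochain hI (f τ) : K̄) • (kleinMatrix (f τ) ((e * m) τ)).1).map σ =
      σ (scalarCochain hI (f τ)) • (kleinMatrix (f τ) ((e * m) τ)).1 := by
    conv_rhs => rw [← kleinMatrix_map σ]
    ext i j
    simp
  -- The matrices contribute the sign of `(e * m) ∪ f`, which splits by bilinearity; its `m ∪ f`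
  -- part cancels the one coming from `scalarCochain_mul`.
  have hcup : ∀ x y z : ℤˣ, (if x * y = -1 ∧ z = -1 then -1 else 1 : ℤˣ) =
      (if x = -1 ∧ z = -1 then -1 else 1) * (if y = -1 ∧ z = -1 then -1 else 1) := by decide
  rw [descentMap_val, descentMap_val, descentMap_val, hmap, smul_mul_smul_comm,
    scalarCochain_mul hI hI2 hm, kleinMatrix_mul, map_mul, map_mul, smul_smul, smul_smul,
    MonoidHom.mul_apply, hcup]
  congr 1
  simp only [cupFun]
  push_cast
  rcases Int.units_eq_one_or (m σ) with h | h <;>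
  rcases Int.units_eq_one_or (f τ) with h' | h' <;> simp [h, h'] <;> ring

/-- A case of Schur's lemma: commuting with `diag(u, -u)` forces a diagonal matrix, and commuting
with the antidiagonal matrix makes its entries equal. It gives uniqueness of descent data up to
scalars. -/
theorem exists_eq_smul_one_of_commute {u v : K̄} (hu : u ≠ 0) (hv : v ≠ 0) {n : GL (Fin 2) K̄}
    (h1 : n * diagUnit hu = diagUnit hu * n) (h2 : n * antidiagUnit hv = antidiagUnit hv * n) :
    n.1 0 0 ≠ 0 ∧ n.1 = n.1 0 0 • 1 := by
  have e1 := congrArg Units.val h1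
  have e2 := congrArg Units.val h2
  have a1 := congrFun (congrFun e1 0) 1
  have a2 := congrFun (congrFun e1 1) 0
  have a3 := congrFun (congrFun e2 0) 1
  simp [diagUnit, Matrix.mul_apply, Fin.sum_univ_two] at a1
  simp [diagUnit, Matrix.mul_apply, Fin.sum_univ_two] at a2
  simp [antidiagUnit, Matrix.mul_apply, Fin.sum_univ_two] at a3
  have b1 : n.1 0 1 = 0 := by
    have : (2 * u) * n.1 0 1 = 0 := by linear_combination -a1
    exact (mul_eq_zero.1 this).resolve_left (by simp [hu])
  have b2 : n.1 1 0 = 0 := by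
    have : (2 * u) * n.1 1 0 = 0 := by linear_combination a2
    exact (mul_eq_zero.1 this).resolve_left (by simp [hu])
  have b3 : n.1 1 1 = n.1 0 0 := by
    have : v * n.1 0 0 = v * n.1 1 1 := by linear_combination a3
    exact (mul_left_cancel₀ hv this).symm
  have hn : n.1 = n.1 0 0 • 1 := by
    ext i j
    fin_cases i <;> fin_cases j <;> simp [b1, b2, b3]
  refine ⟨fun h => ?_, hn⟩
  rw [h, zero_smul] at hn
  exact n.ne_zero hn

/-- A `±1`-valued cochain which is a coboundary of a `K̄ˣ`-valued one is a coboundary of a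
`±1`-valued one. -/
theorem exists_sign_cochain (l : AbsGal K → K̄) (hl : IsLocallyConstant l) (h0 : ∀ σ, l σ ≠ 0)
    (c : AbsGal K × AbsGal K → ℤˣ)
    (hc : ∀ σ τ, l σ * σ (l τ) = ((c (σ, τ) : ℤ) : K̄) * l (σ * τ)) :
    ∃ d : AbsGal K → ℤˣ, IsLocallyConstant d ∧ ∀ σ τ, c (σ, τ) = d σ * d τ * (d (σ * τ))⁻¹ := by
  have hsq : ∀ z : ℤˣ, ((z : ℤ) : K̄) ^ 2 = 1 := fun z => by
    rcases Int.units_eq_one_or z with h | h <;> simp [h]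
  -- Squaring kills the sign, so `l²` is a 1-cocycle, equal to `σ(m)/m` by Hilbert 90. With `m =
  -- r²`, the ratio `l σ * r / σ r` is a sign with the same coboundary as `l`.
  obtain ⟨m, hm0, hm⟩ := exists_eq_div_of_isCocycle (fun σ => l σ ^ 2) (hl.comp (· ^ 2))
    (fun σ => pow_ne_zero _ (h0 σ)) (fun σ τ => by
      rw [map_pow, ← mul_pow, hc, mul_pow, hsq, one_mul])
  obtain ⟨r, hr⟩ := IsAlgClosed.exists_pow_nat_eq m (n := 2) (by norm_num)
  have hr0 : r ≠ 0 := by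
    rintro rfl
    exact hm0 (by simpa using hr.symm)
  have key : ∀ σ : AbsGal K, ∃ z : ℤˣ, l σ * r = ((z : ℤ) : K̄) * σ r := by
    intro σ
    have : l σ * r = σ r ∨ l σ * r = -σ r := by
      apply sq_eq_sq_iff_eq_or_eq_neg.1
      rw [mul_pow, ← map_pow, hr, hm]
    rcases this with h | h
    · exact ⟨1, by simp [h]⟩
    · exact ⟨-1, by simp [h]⟩
  choose d hd using key
  have hσr : ∀ σ : AbsGal K, σ r ≠ 0 := fun σ => (map_ne_zero σ).2 hr0
  refine ⟨d, ?_, fun σ τ => ?_⟩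
  · refine IsLocallyConstant.desc d (fun u : ℤˣ => ((u : ℤ) : K̄)) ?_ intUnits_cast_injective
    convert (hl.prodMk (isLocallyConstant_apply r)).comp fun q : K̄ × K̄ => q.1 * r / q.2 using 1
    funext σ
    simp [hd σ, hσr σ]
  · rw [eq_mul_inv_iff_mul_eq]
    apply intUnits_cast_injective (K := K)
    apply mul_right_cancel₀ (hσr (σ * τ))
    have h1 := hc σ τ
    have h2 : σ (l τ) * σ r = ((d τ : ℤ) : K̄) * σ (τ r) := by
      rw [← map_mul, hd, map_mul, map_intCast]
    have h3 := hd (σ * τ)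
    have h4 := hd σ
    rw [AlgEquiv.mul_apply] at h3 ⊢
    push_cast
    apply mul_right_cancel₀ (hσr σ)
    linear_combination (-((c (σ, τ) : ℤ) : K̄) * σ r) * h3 - r * σ r * h1 +
      l σ * r * h2 + ((d τ : ℤ) : K̄) * σ (τ r) * h4

/-- The class of the quaternion algebra `(εs, t)` in terms of the characters of `√s` and `√t`. -/
theorem isQuaternionClass_iff {s t : K} {r r' : K̄} {e f : AbsGal K →* ℤˣ}
    (hr : r ^ 2 = algebraMap K K̄ s) (hr0 : r ≠ 0) (he : IsSqrtChar r e)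
    (hr' : r' ^ 2 = algebraMap K K̄ t) (hr0' : r' ≠ 0) (hf : IsSqrtChar r' f)
    (hle : IsLocallyConstant e) (hlf : IsLocallyConstant f) (ε : ℤˣ)
    (γ : H2 (AbsGal K) ℤˣ) :
    IsQuaternionClass (QuaternionAlgebra K (((ε : ℤˣ) : ℤ) * s) 0 t) γ ↔
      γ = H2.mk (symbolCocycle 1 ε (by norm_num : (-1 : ℤˣ) ^ 2 = 1) hle hlf) := by
  -- `I = √ε`, so `I * r` is a square root of `εs`, with character `e * m`.
  obtain ⟨I, m, hI2, hI0, hm, hlm⟩ := exists_isSqrtChar (K := K) ((ε : ℤ) : K) (by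
    rcases Int.units_eq_one_or ε with h | h <;> simp [h])
  have hu : (I * r) ^ 2 = algebraMap K K̄ (((ε : ℤˣ) : ℤ) * s) := by
    rw [mul_pow, hI2, hr, map_mul]
  rw [map_intCast] at hI2
  have hu0 : I * r ≠ 0 := mul_ne_zero hI0 hr0
  have hp : IsSqrtChar (I * r) (e * m) := by rw [mul_comm e]; exact hm.mul he
  have hlp : IsLocallyConstant (e * m) := hle.mul hlm
  have hc0 : ∀ σ τ, (symbolCocycle 1 ε (by norm_num : (-1 : ℤˣ) ^ 2 = 1) hle hlf).1 (σ, τ) =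
      cupFun (-1) e f (σ, τ) * cupFun ε f f (σ, τ) := fun σ τ => by
    simp [symbolCocycle_apply, cupFun]
  set c0 := symbolCocycle 1 ε (by norm_num : (-1 : ℤˣ) ^ 2 = 1) hle hlf
  set x0 := descentMap hI0 (e * m) f with hx0
  have hx0l : IsLocallyConstant x0 := isLocallyConstant_descentMap hI0 hlp hlf
  have hx0c : ∀ σ τ, (x0 σ).1 * (x0 τ).1.map σ = ((c0.1 (σ, τ) : ℤ) : K̄) • (x0 (σ * τ)).1 :=
    fun σ τ => by rw [hc0]; exact descentMap_mul hI0 hI2 hm σ τ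
  have hx0φ : ∀ (σ : AbsGal K) (α : QuaternionAlgebra K (((ε : ℤˣ) : ℤ) * s) 0 t),
      (x0 σ).1 * (splitting hu hr' α).map σ = splitting hu hr' α * (x0 σ).1 :=
    descentMap_comm hI0 hu hr' hp hf
  constructor
  · rintro ⟨c, rfl, φ, x, hxl, hxφ, hxc⟩
    obtain ⟨p, hpi, hpj⟩ := exists_conj_splitting hu hr' hu0 hr0' φ
    let S : AbsGal K → GL (Fin 2) K̄ →* GL (Fin 2) K̄ := fun σ =>
      Matrix.GeneralLinearGroup.map (n := Fin 2) ((σ : K̄ →ₐ[K] K̄) : K̄ →+* K̄)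
    have hSl : IsLocallyConstant fun σ => S σ p := isLocallyConstant_generalLinearGroup_map p
    have hSval : ∀ σ (g : GL (Fin 2) K̄), (S σ g).1 = g.1.map σ := fun σ g => rfl
    -- `n` compares the given descent datum, transported by `p`, with the explicit one `x0`. It
    -- commutes with the images of `i` and `j`, hence is scalar, and its scalars show that `c0 * c`
    -- is a coboundary over `K̄ˣ`.
    let n : AbsGal K → GL (Fin 2) K̄ := fun σ => p⁻¹ * x σ * S σ p * (x0 σ)⁻¹
    have hnl : IsLocallyConstant n :=
      (((IsLocallyConstant.const p⁻¹).mul hxl).mul hSl).mul hx0l.inv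
    have hcomm : ∀ (g : GL (Fin 2) K̄) (α : QuaternionAlgebra K (((ε : ℤˣ) : ℤ) * s) 0 t),
        splitting hu hr' α = g.1 → φ α * p.1 = p.1 * g.1 → ∀ σ, n σ * g = g * n σ := by
      intro g α hg hpg σ
      have h1 : x0 σ * S σ g = g * x0 σ := Units.ext (by
        have := hx0φ σ α
        rw [hg] at this
        exact this)
      have hφ : φ α = (p * g * p⁻¹ : GL (Fin 2) K̄).1 := by
        rw [Units.val_mul, Units.val_mul, ← hpg, mul_assoc, ← Units.val_mul]
        simp
      have h2 : x σ * S σ (p * g * p⁻¹) = (p * g * p⁻¹) * x σ := Units.ext (by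
        have := hxφ σ α
        rw [hφ] at this
        exact this)
      rw [map_mul, map_mul, map_inv] at h2
      have h1' : (x0 σ)⁻¹ * g = S σ g * (x0 σ)⁻¹ := by
        rw [inv_mul_eq_iff_eq_mul, ← mul_assoc, h1, mul_inv_cancel_right]
      have h2' : x σ * S σ p * S σ g = p * g * p⁻¹ * x σ * S σ p := by
        rw [← h2]; group
      calc p⁻¹ * x σ * S σ p * (x0 σ)⁻¹ * g = p⁻¹ * (x σ * S σ p * S σ g) * (x0 σ)⁻¹ := by
            rw [mul_assoc _ _ g, h1']; group
        _ = g * (p⁻¹ * x σ * S σ p * (x0 σ)⁻¹) := by rw [h2']; group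
    have hn : ∀ σ, (n σ).1 0 0 ≠ 0 ∧ (n σ).1 = (n σ).1 0 0 • 1 := fun σ =>
      exists_eq_smul_one_of_commute hu0 hr0'
        (hcomm _ _ (splitting_i hu hr' hu0) hpi σ) (hcomm _ _ (splitting_j hu hr' hr0') hpj σ)
    have hx : ∀ σ, (p⁻¹ * x σ * S σ p).1 = (n σ).1 0 0 • (x0 σ).1 := fun σ => by
      have : p⁻¹ * x σ * S σ p = n σ * x0 σ := by simp [n]
      rw [this, Units.val_mul, (hn σ).2, smul_mul_assoc, one_mul]
      simp
    have hSS : ∀ σ τ, S σ (S τ p) = S (σ * τ) p := fun σ τ => rfl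
    have hrel : ∀ σ τ, (n σ).1 0 0 * σ ((n τ).1 0 0) =
        (((c0.1 (σ, τ) * c.1 (σ, τ) : ℤˣ) : ℤ) : K̄) * (n (σ * τ)).1 0 0 := by
      intro σ τ
      have h1 : (p⁻¹ * x σ * S σ p).1 * (p⁻¹ * x τ * S τ p).1.map σ =
          ((c.1 (σ, τ) : ℤ) : K̄) • (p⁻¹ * x (σ * τ) * S (σ * τ) p).1 := by
        rw [← hSval, ← Units.val_mul]
        have : p⁻¹ * x σ * S σ p * S σ (p⁻¹ * x τ * S τ p) =
            p⁻¹ * (x σ * S σ (x τ)) * S (σ * τ) p := by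
          rw [map_mul, map_mul, map_inv, hSS]; group
        rw [this, Units.val_mul, Units.val_mul, Units.val_mul, hSval, hxc, mul_smul_comm,
          smul_mul_assoc, Units.val_mul, Units.val_mul]
      have hmap : ((n τ).1 0 0 • (x0 τ).1).map σ = σ ((n τ).1 0 0) • (x0 τ).1.map σ := by
        ext i j
        simp
      rw [hx, hx, hx, hmap, smul_mul_smul_comm, hx0c, smul_smul, smul_smul] at h1
      have h2 := smul_left_injective K̄ (x0 (σ * τ)).ne_zero h1
      have hc0sq : ((c0.1 (σ, τ) : ℤ) : K̄) * ((c0.1 (σ, τ) : ℤ) : K̄) = 1 := by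
        rcases Int.units_eq_one_or (c0.1 (σ, τ)) with h | h <;> simp [h]
      push_cast
      linear_combination ((c0.1 (σ, τ) : ℤ) : K̄) * h2 -
        (n σ).1 0 0 * σ ((n τ).1 0 0) * hc0sq
    obtain ⟨d, hdl, hd⟩ := exists_sign_cochain (fun σ => (n σ).1 0 0)
      (hnl.comp fun g : GL (Fin 2) K̄ => g.1 0 0) (fun σ => (hn σ).1)
      (fun q => c0.1 q * c.1 q) hrel
    refine H2.mk_eq_mk_iff.2 ⟨d, hdl, fun σ τ => ?_⟩
    rw [← hd, ← mul_assoc, Int.units_mul_self, one_mul]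
  · rintro rfl
    exact ⟨c0, rfl, splitting hu hr', x0, hx0l, hx0φ, hx0c⟩

end QuaternionClass

/-! ### Signs in a field with a real embedding -/

section Signs

variable {F : Type*} [Field F]

theorem toPModSq_eq_one_iff {d : Fˣ} : toPModSq d = 1 ↔ ∃ y : Fˣ, d = y ^ 2 ∨ d = -y ^ 2 := by
  have h : toPModSq d = 1 ↔ (QuotientGroup.mk d : Fˣ ⧸ Subgroup.zpowers (-1 : Fˣ)) ∈
      (powMonoidHom 2 : P F →* P F).range := QuotientGroup.eq_one_iff _
  have hmem : ∀ x : Fˣ, x ∈ Subgroup.zpowers (-1 : Fˣ) ↔ x = 1 ∨ x = -1 := by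
    intro x
    rw [Subgroup.mem_zpowers_iff]
    constructor
    · rintro ⟨k, rfl⟩
      rcases Int.even_or_odd k with hk | hk
      · exact Or.inl hk.neg_one_zpow
      · exact Or.inr hk.neg_one_zpow
    · rintro (rfl | rfl)
      · exact ⟨0, by simp⟩
      · exact ⟨1, by simp⟩
  rw [h]
  constructor
  · rintro ⟨q, hq⟩
    obtain ⟨y, rfl⟩ := QuotientGroup.mk_surjective q
    have h1 : (QuotientGroup.mk (y ^ 2) : Fˣ ⧸ Subgroup.zpowers (-1 : Fˣ)) =
      QuotientGroup.mk d := hq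
    rw [QuotientGroup.eq, hmem] at h1
    refine ⟨y, ?_⟩
    rcases h1 with h1 | h1
    · exact Or.inl (inv_mul_eq_one.1 h1).symm
    · exact Or.inr (by rw [inv_mul_eq_iff_eq_mul] at h1; simpa using h1)
  · rintro ⟨y, hy⟩
    refine ⟨(QuotientGroup.mk y : Fˣ ⧸ Subgroup.zpowers (-1 : Fˣ)), ?_⟩
    change (QuotientGroup.mk (y ^ 2) : Fˣ ⧸ Subgroup.zpowers (-1 : Fˣ)) = QuotientGroup.mk d
    rw [QuotientGroup.eq, hmem]
    rcases hy with rfl | rfl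
    · exact Or.inl (by simp)
    · exact Or.inr (by simp)

theorem toPModSq_eq_one_of_sq_eq_one {d : Fˣ} (h : d = 1 ∨ d = -1) : toPModSq d = 1 :=
  toPModSq_eq_one_iff.2 ⟨1, by simpa using h⟩

variable (ι : F →+* ℝ)

theorem signMap_of_pos {a : Fˣ} (ha : 0 < ι a) : signMap ι a = 1 := if_pos ha

theorem signMap_neg_one : signMap ι (-1) = -1 := if_neg (by simp)

/-- The inclusion of `{±1}` in `F^*`. -/
def signInclusion (F : Type*) [Field F] : ℤˣ →* Fˣ := Units.map (Int.castRingHom F : ℤ →* F)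

theorem eq_signInclusion_signMap {x : Fˣ} (h : x ^ 2 = 1 ∨ x ^ 2 = -1) :
    x = signInclusion F (signMap ι x) := by
  have hx : ι x ≠ 0 := (map_ne_zero ι).2 x.ne_zero
  have hneg : x ^ 2 ≠ -1 := by
    intro h'
    have := congrArg (fun y : Fˣ => ι y) h'
    simp at this
    nlinarith [sq_nonneg (ι x)]
  have h1 : (x : F) ^ 2 = 1 := by
    simpa using congrArg Units.val (h.resolve_right hneg)
  rcases sq_eq_one_iff.1 h1 with h1 | h1
  · obtain rfl : x = 1 := Units.ext h1
    simp
  · obtain rfl : x = -1 := Units.ext h1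
    rw [signMap_neg_one]
    ext
    simp [signInclusion]

end Signs

/-! ### The two components of a 2-torsion class -/

section Components

variable {F : Type*} [Field F] {G : Type*} [Group G] [TopologicalSpace G]

/-- By compactness the image is finite, so its elements are roots of unity in a real field. -/
theorem hom_eq_one_or_neg_one [CompactSpace G] (ι : F →+* ℝ) (χ : G →* Fˣ)
    (hχ : IsLocallyConstant χ) (g : G) : χ g = 1 ∨ χ g = -1 := by
  have hfin : Finite χ.range := hχ.range_finite.to_subtype
  have hord : IsOfFinOrder (χ g) := by
    have h := isOfFinOrder_of_finite (⟨χ g, g, rfl⟩ : χ.range)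
    exact (Subgroup.subtype _).isOfFinOrder h
  obtain ⟨n, hn, h⟩ := isOfFinOrder_iff_pow_eq_one.1 hord
  have h1 : (ι (χ g)) ^ n = 1 := by
    rw [← map_pow, ← Units.val_pow_eq_pow_val, h]
    simp
  have h2 : |ι (χ g)| = 1 := by
    rw [← pow_eq_one_iff_of_nonneg (abs_nonneg _) hn.ne', ← abs_pow, h1, abs_one]
  rcases (abs_eq zero_le_one).1 h2 with h | h
  · exact Or.inl (Units.ext (ι.injective (by simpa using h)))
  · exact Or.inr (Units.ext (ι.injective (by simpa using h)))

/-- Additive form of the multiplicativity of `d0 / (d η²)`, the discrepancy between two choices of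
`(c, d)` in `pComponent_mk_apply`. -/
theorem twisted_add_of_coboundary_eq {M : Type*} [AddCommGroup M] {A B C p q r x y z : M}
    (h : A + B + -C + 2 • (p + q + -r) = x + y + -z) :
    z + -(C + 2 • r) = (x + -(A + 2 • p)) + (y + -(B + 2 • q)) := by
  have hz : z = x + y - (A + B + -C + 2 • (p + q + -r)) := by rw [h]; abel
  rw [hz]
  module

/-- Independence of the choice of `(c, d)`: up to squares, two choices of `d` differ by a continuous
homomorphism to `F^*`. It takes values in `±1`, hence dies in `P/P²`. -/
theorem pComponent_mk_apply [CompactSpace G] (ι : F →+* ℝ) {c : cocycles2 G Fˣ} {d : G → Fˣ}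
    (hd : IsLocallyConstant d) (h : ∀ g h : G, c.1 (g, h) ^ 2 = d g * d h * (d (g * h))⁻¹)
    (hγ : (H2.mk c) ^ 2 = 1) (g : G) : pComponent (H2.mk c) hγ g = toPModSq (d g) := by
  have hs := exists_of_sq_eq_one (H2.mk c) hγ
  obtain ⟨hc0, hd0, h0⟩ := hs.choose_spec.choose_spec
  change toPModSq (hs.choose_spec.choose g) = _
  set d0 := hs.choose_spec.choose
  set c0 := hs.choose
  obtain ⟨η, hη, hη'⟩ := H2.mk_eq_mk_iff.1 hc0
  let χ : G →* Fˣ := MonoidHom.mk' (fun g => d0 g * (d g * η g ^ 2)⁻¹) fun g h' => by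
    have e0 := h0 g h'
    rw [hη', mul_pow, h] at e0
    exact twisted_add_of_coboundary_eq (M := Additive Fˣ) e0
  have hχ : IsLocallyConstant χ := hd0.mul ((hd.mul (hη.comp (· ^ 2))).inv)
  have h1 := toPModSq_eq_one_of_sq_eq_one (hom_eq_one_or_neg_one ι χ hχ g)
  change toPModSq (d0 g * (d g * η g ^ 2)⁻¹) = 1 at h1
  rwa [map_mul, map_inv, map_mul, map_pow, PModSq_sq, mul_one, mul_inv_eq_one] at h1

/-- A 2-torsion class is determined by its two components. -/
theorem eq_of_components [CompactSpace G] (ι : F →+* ℝ) {γ γ' : H2 G Fˣ} (hγ : γ ^ 2 = 1)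
    (hγ' : γ' ^ 2 = 1) (hp : pComponent γ hγ = pComponent γ' hγ')
    (hs : signComponent ι γ = signComponent ι γ') : γ = γ' := by
  obtain ⟨c, d, rfl, hd, hcd⟩ := exists_of_sq_eq_one γ hγ
  obtain ⟨c', d', rfl, hd', hcd'⟩ := exists_of_sq_eq_one γ' hγ'
  obtain ⟨η, hη, hcη⟩ := H2.mk_eq_mk_iff.1 (show H2.mk (cocycles2Map (signMap ι) c) =
    H2.mk (cocycles2Map (signMap ι) c') from hs)
  change ∀ g h : G, signMap ι (c.1 (g, h)) = signMap ι (c'.1 (g, h)) * _ at hcη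
  have hq : ∀ g, ∃ y : Fˣ, d g * (d' g)⁻¹ = y ^ 2 ∨ d g * (d' g)⁻¹ = -y ^ 2 := fun g => by
    rw [← toPModSq_eq_one_iff, map_mul, map_inv, mul_inv_eq_one,
      ← pComponent_mk_apply ι hd hcd hγ, hp, pComponent_mk_apply ι hd' hcd' hγ']
  obtain ⟨y, hyl, hy⟩ : ∃ y : G → Fˣ, IsLocallyConstant y ∧
      ∀ g, d g * (d' g)⁻¹ = y g ^ 2 ∨ d g * (d' g)⁻¹ = -y g ^ 2 := by
    classical
    -- The root is chosen as a function of the value `d g / d' g`, so that `y` stays locally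
    -- constant.
    let Y : Fˣ → Fˣ := fun x =>
      if h : ∃ y : Fˣ, x = y ^ 2 ∨ x = -y ^ 2 then h.choose else 1
    refine ⟨fun g => Y (d g * (d' g)⁻¹), (hd.mul hd'.inv).comp Y, fun g => ?_⟩
    simp only [Y, dif_pos (hq g)]
    exact (hq g).choose_spec
  have hu : ∀ g, d g * (d' g)⁻¹ * ((y g) ^ 2)⁻¹ = 1 ∨ d g * (d' g)⁻¹ * ((y g) ^ 2)⁻¹ = -1 := by
    intro g
    rcases hy g with h | h <;> rw [h] <;> simp
  -- After division by the coboundary of `y`, the quotient `x` of the cocycles has `x² = ±1`, so it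
  -- equals its own sign. That sign is the coboundary of `η` divided by the sign of `y`, whence the
  -- second factor.
  refine H2.mk_eq_mk_iff.2 ⟨fun g => y g * signInclusion F (η g * (signMap ι (y g))⁻¹),
    hyl.mul ((hη.mul (hyl.comp (signMap ι)).inv).comp (signInclusion F)), fun g h => ?_⟩
  set x := c.1 (g, h) * (c'.1 (g, h))⁻¹ * (y g * y h * (y (g * h))⁻¹)⁻¹ with hx
  have hx2 : x ^ 2 = 1 ∨ x ^ 2 = -1 := by
    have e : x ^ 2 = (d g * (d' g)⁻¹ * ((y g) ^ 2)⁻¹) * (d h * (d' h)⁻¹ * ((y h) ^ 2)⁻¹) *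
        (d (g * h) * (d' (g * h))⁻¹ * ((y (g * h)) ^ 2)⁻¹)⁻¹ := by
      rw [hx, mul_pow, mul_pow, inv_pow, hcd, hcd']
      simp only [mul_inv, mul_pow, inv_pow, inv_inv]
      simp only [mul_assoc, mul_comm, mul_left_comm]
    rw [e]
    rcases hu g with h1 | h1 <;> rcases hu h with h2 | h2 <;> rcases hu (g * h) with h3 | h3 <;>
      simp [h1, h2, h3]
  have hx3 := eq_signInclusion_signMap ι hx2
  have hx4 : signMap ι x = (η g * (signMap ι (y g))⁻¹) * (η h * (signMap ι (y h))⁻¹) *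
      (η (g * h) * (signMap ι (y (g * h)))⁻¹)⁻¹ := by
    rw [hx]
    simp only [map_mul, map_inv, hcη, mul_inv_cancel_comm, mul_inv, inv_inv]
    simp only [mul_assoc, mul_comm, mul_left_comm]
  rw [hx4, hx] at hx3
  have e : c.1 (g, h) = c'.1 (g, h) * ((y g * y h * (y (g * h))⁻¹) *
      (c.1 (g, h) * (c'.1 (g, h))⁻¹ * (y g * y h * (y (g * h))⁻¹)⁻¹)) := by
    rw [mul_comm (c.1 (g, h) * _), mul_inv_cancel_left, mul_comm (c.1 (g, h)),
      mul_inv_cancel_left]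
  rw [hx3] at e
  rw [e, map_mul, map_mul, map_inv]
  simp only [mul_inv]
  simp only [mul_assoc, mul_comm, mul_left_comm]

/-- For the 0/1-valued lift `ε` of a character, `ε(g) + ε(h) - ε(gh) = 2 ε(g) ε(h)`; this makes the
squares of the `a` and `b` factors coboundaries. -/
theorem symbolCocycle_sq (a b : Fˣ) {z : Fˣ} (hz : z ^ 2 = 1) {e f : G →* ℤˣ}
    (he : IsLocallyConstant e) (hf : IsLocallyConstant f) (g h : G) :
    (symbolCocycle a b hz he hf).1 (g, h) ^ 2 =
      ((if e g = -1 then a else 1) * (if f g = -1 then b else 1)) *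
      ((if e h = -1 then a else 1) * (if f h = -1 then b else 1)) *
      ((if e (g * h) = -1 then a else 1) * (if f (g * h) = -1 then b else 1))⁻¹ := by
  have hz' : (cupFun z e f (g, h)) ^ 2 = 1 := by
    unfold cupFun
    split_ifs <;> simp [hz]
  have key : ∀ (m : Fˣ) (e : G →* ℤˣ), cupFun m e e (g, h) ^ 2 = (if e g = -1 then m else 1) *
      (if e h = -1 then m else 1) * (if e (g * h) = -1 then m else 1)⁻¹ := by
    intro m e
    rw [map_mul]
    rcases Int.units_eq_one_or (e g) with h1 | h1 <;>
    rcases Int.units_eq_one_or (e h) with h2 | h2 <;> simp [cupFun, h1, h2, sq]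
  rw [symbolCocycle_apply, mul_pow, mul_pow, hz', one_mul, key, key, mul_inv]
  simp only [mul_assoc, mul_comm, mul_left_comm]

theorem mk_symbolCocycle_sq_eq_one (a b : Fˣ) {z : Fˣ} (hz : z ^ 2 = 1) {e f : G →* ℤˣ}
    (he : IsLocallyConstant e) (hf : IsLocallyConstant f) :
    (H2.mk (symbolCocycle a b hz he hf)) ^ 2 = 1 := by
  refine H2.mk_eq_mk_iff (c := symbolCocycle a b hz he hf ^ 2) (c' := 1) |>.2
    ⟨_, (he.prodMk hf).comp fun q : ℤˣ × ℤˣ => (if q.1 = -1 then a else 1) *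
      (if q.2 = -1 then b else 1), fun g h => ?_⟩
  exact (symbolCocycle_sq a b hz he hf g h).trans (one_mul _).symm

theorem pComponent_mk_symbolCocycle [CompactSpace G] (ι : F →+* ℝ) (a b : Fˣ) {z : Fˣ}
    (hz : z ^ 2 = 1) {e f : G →* ℤˣ} (he : IsLocallyConstant e) (hf : IsLocallyConstant f)
    (hγ : (H2.mk (symbolCocycle a b hz he hf)) ^ 2 = 1) (g : G) :
    pComponent _ hγ g = (if e g = -1 then toPModSq a else 1) *
      (if f g = -1 then toPModSq b else 1) := by
  rw [pComponent_mk_apply ι ((he.prodMk hf).comp fun q : ℤˣ × ℤˣ =>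
    (if q.1 = -1 then a else 1) * (if q.2 = -1 then b else 1))
    (symbolCocycle_sq a b hz he hf) hγ]
  change toPModSq ((if e g = -1 then a else 1) * (if f g = -1 then b else 1)) = _
  rw [map_mul]
  split_ifs <;> simp

/-- Positivity of `a` removes the `e ∪ e` term, leaving exactly the shape found in
`isQuaternionClass_iff`. -/
theorem signComponent_mk_symbolCocycle (ι : F →+* ℝ) {a : Fˣ} (ha : 0 < ι a) (b : Fˣ)
    {e f : G →* ℤˣ} (he : IsLocallyConstant e) (hf : IsLocallyConstant f) :
    signComponent ι (H2.mk (symbolCocycle a b (by norm_num : (-1 : Fˣ) ^ 2 = 1) he hf)) =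
      H2.mk (symbolCocycle 1 (signMap ι b) (by norm_num : (-1 : ℤˣ) ^ 2 = 1) he hf) := by
  rw [signComponent, H2.map_mk_symbolCocycle (signMap ι) a b _ (by simp [signMap_neg_one])]
  congr 1
  ext p
  rw [symbolCocycle_apply, symbolCocycle_apply, signMap_of_pos ι ha, signMap_neg_one]

end Components

/-! ### Generators of the quaternion algebra, and signs of their squares -/

section Algebra

variable {F B : Type*} [Field F] [DivisionRing B] [Algebra F B]

/-- In a division algebra, `1, α, β, αβ` are linearly independent if `α²` and `β²` are scalars,
and `α`, `β`, `α⁻¹β` are not. -/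
theorem eq_zero_of_quaternion_combination [CharZero F] {α β : B} {a b : F}
    (hα : α * α = algebraMap F B a) (hβ : β * β = algebraMap F B b)
    (hα' : ∀ x : F, algebraMap F B x ≠ α) (hβ' : ∀ x : F, algebraMap F B x ≠ β)
    (hαβ : ∀ x : F, x • α ≠ β) {x y z w : F}
    (h : algebraMap F B x + y • α + z • β + w • (α * β) = 0) :
    x = 0 ∧ y = 0 ∧ z = 0 ∧ w = 0 := by
  have hlin : ∀ {p q : F}, algebraMap F B p + q • α = 0 → p = 0 ∧ q = 0 := by
    intro p q hpq
    have hq : q = 0 := by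
      by_contra hq
      refine hα' (q⁻¹ * -p) ?_
      rw [Algebra.algebraMap_eq_smul_one, mul_smul, inv_smul_eq_iff₀ hq, neg_smul,
        ← Algebra.algebraMap_eq_smul_one]
      exact neg_eq_of_add_eq_zero_right hpq
    subst hq
    exact ⟨by simpa using hpq, rfl⟩
  -- `β` lies outside the field `F(α)`: as `(p + qα)²` is scalar only if `2pq = 0`, `β` would be a
  -- scalar or a multiple of `α`.
  have hβlin : ∀ p q : F, algebraMap F B p + q • α ≠ β := by
    intro p q hpq
    have h1 : algebraMap F B (p * p + q * q * a - b) + (2 * p * q) • α = 0 := by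
      have : β * β = algebraMap F B (p * p + q * q * a) + (2 * p * q) • α := by
        rw [← hpq]
        simp only [Algebra.algebraMap_eq_smul_one] at hα ⊢
        simp only [add_mul, mul_add, smul_mul_assoc, mul_smul_comm, one_mul, mul_one, hα]
        module
      rw [map_sub, ← hβ, this]
      abel
    have h2 := (hlin h1).2
    rcases mul_eq_zero.1 h2 with h3 | h3
    · have hp : p = 0 := by simpa using h3
      subst hp
      exact hαβ q (by simpa using hpq)
    · subst h3
      exact hβ' p (by simpa using hpq)
  have hn : ∀ {p q : F}, algebraMap F B (p * p - q * q * a) =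
      (algebraMap F B p - q • α) * (algebraMap F B p + q • α) := by
    intro p q
    simp only [Algebra.algebraMap_eq_smul_one] at hα ⊢
    simp only [sub_mul, mul_add, smul_mul_assoc, mul_smul_comm, one_mul, mul_one, hα]
    module
  -- The relation reads `(x + yα) + (z + wα)β = 0`. If `z + wα` were nonzero, multiplying by its
  -- conjugate `z - wα` and dividing by the norm `z² - w²a` would put `β` in `F(α)`.
  have hzw : algebraMap F B z + w • α = 0 := by
    by_contra h0
    have h0' : algebraMap F B z - w • α ≠ 0 := by
      intro h1
      have h2 := hlin (p := z) (q := -w) (by rw [neg_smul, ← sub_eq_add_neg, h1])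
      have h3 : w = 0 := neg_eq_zero.1 h2.2
      rw [h2.1, h3] at h0
      simp at h0
    have hN : z * z - w * w * a ≠ 0 := by
      intro h1
      have h2 := hn (p := z) (q := w)
      rw [h1, map_zero] at h2
      exact (mul_ne_zero h0' h0) h2.symm
    refine hβlin ((z * z - w * w * a)⁻¹ * -(z * x - w * y * a))
      ((z * z - w * w * a)⁻¹ * -(z * y - w * x)) ?_
    have h1 : (algebraMap F B z - w • α) *
        (algebraMap F B x + y • α + z • β + w • (α * β)) = 0 := by rw [h, mul_zero]
    have h2 : (z * z - w * w * a) • β =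
        -((z * x - w * y * a) • 1) + -((z * y - w * x) • α) := by
      rw [eq_comm, ← sub_eq_zero, ← neg_eq_zero, ← h1]
      simp only [Algebra.algebraMap_eq_smul_one] at hα ⊢
      simp only [sub_mul, mul_add, smul_mul_assoc, mul_smul_comm, one_mul, mul_one, hα,
        ← mul_assoc]
      module
    rw [Algebra.algebraMap_eq_smul_one, mul_smul, mul_smul, ← smul_add,
      inv_smul_eq_iff₀ hN, h2, neg_smul, neg_smul]
  obtain ⟨rfl, rfl⟩ := hlin hzw
  obtain ⟨rfl, rfl⟩ := hlin (p := x) (q := y) (by simpa using h)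
  exact ⟨rfl, rfl, rfl, rfl⟩

theorem not_commute_of_finrank_eq_four [CharZero F] [Algebra.IsCentral F B]
    (hdim : Module.finrank F B = 4) {α β : B} {a b : F}
    (hα : α * α = algebraMap F B a) (hβ : β * β = algebraMap F B b)
    (hα' : ∀ x : F, algebraMap F B x ≠ α) (hβ' : ∀ x : F, algebraMap F B x ≠ β)
    (hαβ : ∀ x : F, x • α ≠ β) : α * β ≠ β * α := by
  intro hc
  have hli : LinearIndependent F ![1, α, β, α * β] := by
    rw [Fintype.linearIndependent_iff]
    intro g hg
    simp [Fin.sum_univ_four, ← Algebra.algebraMap_eq_smul_one] at hg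
    obtain ⟨h0, h1, h2, h3⟩ := eq_zero_of_quaternion_combination hα hβ hα' hβ' hαβ hg
    intro i
    fin_cases i <;> assumption
  have : FiniteDimensional F B := FiniteDimensional.of_finrank_pos (by omega)
  -- The four independent elements span `B`, and `α` commutes with each of them, so `α` would be a
  -- scalar.
  have hspan := hli.span_eq_top_of_card_eq_finrank' (by simp [hdim])
  have hcen : α ∈ Subalgebra.center F B := by
    rw [Subalgebra.mem_center_iff]
    intro x
    have hx : x ∈ Submodule.span F (Set.range ![1, α, β, α * β]) := hspan ▸ Submodule.mem_top
    induction hx using Submodule.span_induction with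
    | mem x hx =>
      obtain ⟨i, rfl⟩ := hx
      fin_cases i
      · simp
      · simp
      · exact hc.symm
      · change α * β * α = α * (α * β)
        rw [mul_assoc, ← hc]
    | zero => simp
    | add x y _ _ hx hy => rw [add_mul, mul_add, hx, hy]
    | smul r x _ hx => rw [smul_mul_assoc, mul_smul_comm, hx]
  obtain ⟨x, hx⟩ := Algebra.mem_bot.1 (Algebra.IsCentral.out hcen)
  exact hα' x hx

theorem nonempty_algEquiv_quaternionAlgebra [CharZero F]
    (hdim : Module.finrank F B = 4) {α β : B} {a b : F}
    (hα : α * α = algebraMap F B a) (hβ : β * β = algebraMap F B b)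
    (hα' : ∀ x : F, algebraMap F B x ≠ α) (hβ' : ∀ x : F, algebraMap F B x ≠ β)
    (hαβ : ∀ x : F, x • α ≠ β) (hanti : α * β = -(β * α)) :
    Nonempty (B ≃ₐ[F] QuaternionAlgebra F a 0 b) := by
  let q : QuaternionAlgebra.Basis B a 0 b :=
    { i := α, j := β, k := α * β
      i_mul_i := by rw [hα, Algebra.algebraMap_eq_smul_one, zero_smul, add_zero]
      j_mul_j := by rw [hβ, Algebra.algebraMap_eq_smul_one]
      i_mul_j := rfl
      j_mul_i := by rw [hanti]; simp }
  have hinj : Function.Injective q.liftHom := by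
    rw [injective_iff_map_eq_zero]
    intro x hx
    obtain ⟨h0, h1, h2, h3⟩ := eq_zero_of_quaternion_combination hα hβ hα' hβ' hαβ
      (x := x.re) (y := x.imI) (z := x.imJ) (w := x.imK) hx
    ext <;> assumption
  have : FiniteDimensional F B := FiniteDimensional.of_finrank_pos (by omega)
  have hsurj : Function.Surjective q.liftHom :=
    (LinearMap.injective_iff_surjective_of_finrank_eq_finrank (f := q.liftHom.toLinearMap)
      (by rw [hdim, QuaternionAlgebra.finrank_eq_four])).1 hinj
  exact ⟨(AlgEquiv.ofBijective q.liftHom ⟨hinj, hsurj⟩).symm⟩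

/-- Anticommuting real `2 × 2` matrices do not both have negative scalar squares. -/
theorem Matrix.not_neg_sq_of_anticommute {I J : Matrix (Fin 2) (Fin 2) ℝ} {a b : ℝ}
    (hI : I * I = a • 1) (hJ : J * J = b • 1) (hIJ : I * J = -(J * I)) (ha : a < 0) :
    0 ≤ b := by
  by_contra! hb
  have key : ∀ {M : Matrix (Fin 2) (Fin 2) ℝ} {c : ℝ}, M * M = c • 1 → c < 0 →
      M 1 1 = -M 0 0 ∧ M 0 0 * M 0 0 + M 0 1 * M 1 0 = c := by
    intro M c hM hc
    have h00 := congrFun (congrFun hM 0) 0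
    have h01 := congrFun (congrFun hM 0) 1
    have h10 := congrFun (congrFun hM 1) 0
    simp [Matrix.mul_apply, Fin.sum_univ_two] at h00 h01 h10
    refine ⟨?_, h00⟩
    have e1 : (M 0 0 + M 1 1) * M 0 1 = 0 := by linear_combination h01
    rcases mul_eq_zero.1 e1 with h | h
    · linarith
    · rw [h] at h00
      nlinarith [mul_self_nonneg (M 0 0)]
  -- Both matrices are traceless, with squares `x² + yz = a` and `p² + qr = b`, and anticommutation
  -- gives `2xp + yr + qz = 0`. Then `4x²p² = (yr + qz)² ≥ 4(yz)(qr)`, whereas negative `a`, `b`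
  -- give `x²p² < (yz)(qr)`.
  obtain ⟨i1, i2⟩ := key hI ha
  obtain ⟨j1, j2⟩ := key hJ hb
  have h := congrFun (congrFun hIJ 0) 0
  simp [Matrix.mul_apply, Fin.sum_univ_two] at h
  set x := I 0 0
  set y := I 0 1
  set z := I 1 0
  set p := J 0 0
  set q := J 0 1
  set r := J 1 0
  have h1 : (2 * (x * p)) ^ 2 = (y * r + q * z) ^ 2 := by
    have : 2 * (x * p) = -(y * r + q * z) := by linarith
    rw [this, neg_sq]
  have h2 : x * x * (p * p) < (-(y * z)) * (-(q * r)) := by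
    apply mul_lt_mul'' <;> nlinarith [mul_self_nonneg x, mul_self_nonneg p]
  nlinarith [sq_nonneg (y * r - q * z)]

theorem pos_or_pos_of_isTotallyIndefinite (ι : F →+* ℝ) (hB : IsTotallyIndefinite F B)
    {α β : B} {a b : Fˣ} (hα : α * α = algebraMap F B a) (hβ : β * β = algebraMap F B b)
    (hanti : α * β = -(β * α)) : 0 < ι a ∨ 0 < ι b := by
  by_contra! hneg
  let _ : Algebra F ℝ := ι.toAlgebra
  obtain ⟨θ⟩ := hB ι
  let g : B →+* Matrix (Fin 2) (Fin 2) ℝ :=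
    (θ : (ℝ ⊗[F] B) →+* Matrix (Fin 2) (Fin 2) ℝ).comp
      (Algebra.TensorProduct.includeRight : B →ₐ[F] ℝ ⊗[F] B)
  have hg : ∀ x : F, g (algebraMap F B x) = ι x • 1 := by
    intro x
    have h1 : (Algebra.TensorProduct.includeRight : B →ₐ[F] ℝ ⊗[F] B) (algebraMap F B x) =
        algebraMap ℝ (ℝ ⊗[F] B) (ι x) := by
      rw [AlgHom.commutes]
      rfl
    change θ (Algebra.TensorProduct.includeRight (algebraMap F B x)) = _
    rw [h1, AlgEquiv.commutes, Algebra.algebraMap_eq_smul_one]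
  have ha : ι a < 0 := lt_of_le_of_ne hneg.1 ((map_ne_zero ι).2 a.ne_zero)
  have hb : ι b < 0 := lt_of_le_of_ne hneg.2 ((map_ne_zero ι).2 b.ne_zero)
  refine hb.not_ge (Matrix.not_neg_sq_of_anticommute (I := g α) (J := g β) ?_ ?_ ?_ ha)
  · rw [← map_mul, hα, hg]
  · rw [← map_mul, hβ, hg]
  · rw [← map_mul, hanti, map_neg, map_mul]

end Algebra

/-! ### Klein four-subgroups of `B^*/F^*` and the connecting map -/

section KleinLift

variable {F B : Type*} [Field F] [DivisionRing B] [Algebra F B]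

theorem mk_eq_mk_iff_exists_smul {α β : Bˣ} :
    (QuotientGroup.mk α : ProjUnits F B) = QuotientGroup.mk β ↔
      ∃ x : F, x • (α : B) = β := by
  rw [QuotientGroup.eq]
  constructor
  · rintro ⟨x, hx⟩
    refine ⟨x, ?_⟩
    have : β = α * Units.map (algebraMap F B : F →* B) x := by rw [hx]; group
    rw [this, Algebra.smul_def, Algebra.commutes]
    rfl
  · rintro ⟨x, hx⟩
    have hx0 : x ≠ 0 := by
      rintro rfl
      exact β.ne_zero (by rw [← hx, zero_smul])
    refine ⟨Units.mk0 x hx0, ?_⟩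
    rw [eq_inv_mul_iff_mul_eq]
    ext
    rw [← hx, Algebra.smul_def, Algebra.commutes]
    rfl

/-- The element `β^y α^x`. -/
def kleinLift (α β : Bˣ) (x y : ℤˣ) : Bˣ :=
  (if y = -1 then β else 1) * (if x = -1 then α else 1)

/-- The product is `β^y α^x β^y' α^x'`; moving `α^x` past `β^y'` produces the sign, in the order of
arguments used by `symbolCocycle`. -/
theorem kleinLift_mul {α β : Bˣ} {a b : Fˣ}
    (hα : (α : B) * α = algebraMap F B a) (hβ : (β : B) * β = algebraMap F B b)
    (hanti : (α : B) * β = -(β * α)) (x y x' y' : ℤˣ) :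
    Units.map (algebraMap F B : F →* B) ((if x = -1 ∧ y' = -1 then -1 else 1) *
      (if x = -1 ∧ x' = -1 then a else 1) * (if y = -1 ∧ y' = -1 then b else 1)) *
        kleinLift α β (x * x') (y * y') = kleinLift α β x y * kleinLift α β x' y' := by
  ext
  have hβ1 : ∀ z : B, (β : B) * (β * z) = b • z := fun z => by
    rw [← mul_assoc, hβ, ← Algebra.smul_def, Units.smul_def]
  have hα0 : (α : B) * α = a • 1 := by
    rw [hα, Algebra.algebraMap_eq_smul_one, Units.smul_def]
  have hβ0 : (β : B) * β = b • 1 := by simpa using hβ1 1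
  have hanti1 : ∀ z : B, (α : B) * (β * z) = -(β * (α * z)) := fun z => by
    rw [← mul_assoc, hanti, neg_mul, mul_assoc]
  rw [Units.val_mul]
  change algebraMap F B _ * _ = _
  rw [← Algebra.smul_def]
  rcases Int.units_eq_one_or x with rfl | rfl <;>
  rcases Int.units_eq_one_or y with rfl | rfl <;>
  rcases Int.units_eq_one_or x' with rfl | rfl <;>
  rcases Int.units_eq_one_or y' with rfl | rfl <;>
  simp [kleinLift, mul_assoc, hβ1, hα0, hβ0, hanti, hanti1, Units.smul_def, mul_smul,
    smul_comm (a : F) (b : F)]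

variable {G : Type*} [Group G] [TopologicalSpace G]

/-- Any continuous lift computes `δ`: two lifts differ by a continuous cochain `η` with central
values in `F^*`, whose coboundary relates the cocycles. -/
theorem delta_eq_mk [IsTopologicalGroup G] (ψ : G →* ProjUnits F B) (hψ : IsLocallyConstant ψ)
    (L : G → Bˣ) (hL : IsLocallyConstant L) (hψL : ∀ g, ψ g = QuotientGroup.mk (L g))
    (c : cocycles2 G Fˣ) (hc : ∀ g h, Units.map (algebraMap F B : F →* B) (c.1 (g, h)) *
      L (g * h) = L g * L h) : delta ψ hψ = H2.mk c := by
  have inj : Function.Injective (Units.map (algebraMap F B : F →* B)) :=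
    Units.map_injective (algebraMap F B).injective
  have central : ∀ (f : Fˣ) (b : Bˣ), b * Units.map (algebraMap F B : F →* B) f =
      Units.map (algebraMap F B : F →* B) f * b := fun f b => by
    ext
    exact (Algebra.commutes (f : F) (b : B)).symm
  have hex : ∀ g, ∃ f : Fˣ, Units.map (algebraMap F B : F →* B) f = liftFun ψ g * (L g)⁻¹ := by
    intro g
    have h1 : (QuotientGroup.mk (liftFun ψ g) : ProjUnits F B) = QuotientGroup.mk (L g) := by
      rw [← hψL]
      exact QuotientGroup.out_eq' _
    have h2 : liftFun ψ g * (L g)⁻¹ ∈ scalarUnits F B := by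
      rw [← QuotientGroup.eq_one_iff, QuotientGroup.mk_mul, QuotientGroup.mk_inv, h1,
        mul_inv_cancel]
    exact h2
  let η : G → Fˣ := fun g =>
    Function.invFun (Units.map (algebraMap F B : F →* B)) (liftFun ψ g * (L g)⁻¹)
  have hηl : IsLocallyConstant η :=
    IsLocallyConstant.comp (IsLocallyConstant.mul (f := liftFun ψ) (hψ.comp Quotient.out) hL.inv)
      (Function.invFun (Units.map (algebraMap F B : F →* B)))
  have hη : ∀ g, liftFun ψ g = Units.map (algebraMap F B : F →* B) (η g) * L g := fun g => by
    rw [Function.invFun_eq (hex g), inv_mul_cancel_right]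
  refine H2.mk_eq_mk_iff.2 ⟨η, hηl, fun g h => inj ?_⟩
  change Units.map _ (deltaFun ψ (g, h)) = _
  rw [deltaFun_spec, hη, hη, hη, mul_inv_rev, map_mul, map_mul, map_mul, map_inv,
    mul_inv_eq_iff_eq_mul.2 (hc g h).symm |>.symm]
  have e1 := central (η h) (L g)
  have e2 := central (η (g * h))⁻¹ (L g * L h * (L (g * h))⁻¹)
  rw [map_inv] at e2
  calc _ = Units.map (algebraMap F B : F →* B) (η g) *
        (L g * Units.map (algebraMap F B : F →* B) (η h)) * L h * (L (g * h))⁻¹ *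
        (Units.map (algebraMap F B : F →* B) (η (g * h)))⁻¹ := by group
    _ = Units.map (algebraMap F B : F →* B) (η g * η h) * ((L g * L h * (L (g * h))⁻¹) *
        (Units.map (algebraMap F B : F →* B) (η (g * h)))⁻¹) := by rw [e1, map_mul]; group
    _ = _ := by
      rw [e2, ← map_inv, ← mul_assoc, ← map_mul, ← central, map_mul, map_mul]

theorem delta_eq_mk_symbolCocycle [IsTopologicalGroup G] (ψ : G →* ProjUnits F B)
    (hψ : IsLocallyConstant ψ) {α β : Bˣ} {a b : Fˣ}
    (hα : (α : B) * α = algebraMap F B a) (hβ : (β : B) * β = algebraMap F B b)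
    (hanti : (α : B) * β = -(β * α)) {e f : G →* ℤˣ} (he : IsLocallyConstant e)
    (hf : IsLocallyConstant f)
    (h : ∀ g, ψ g = QuotientGroup.mk (kleinLift α β (e g) (f g))) :
    delta ψ hψ = H2.mk (symbolCocycle a b (by norm_num : (-1 : Fˣ) ^ 2 = 1) he hf) :=
  delta_eq_mk ψ hψ _ ((he.prodMk hf).comp fun q : ℤˣ × ℤˣ => kleinLift α β q.1 q.2) h _
    fun g h => by
      have := kleinLift_mul hα hβ hanti (e g) (f g) (e h) (f h)
      rw [← map_mul, ← map_mul] at this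
      exact this

/-- A Klein four-subgroup of `B^*/F^*` is generated by the classes of two anticommuting
elements. -/
theorem exists_anticommuting_lifts [CharZero F] [Algebra.IsCentral F B]
    (hdim : Module.finrank F B = 4) (θ : ℤˣ × ℤˣ →* ProjUnits F B)
    (hθ : Function.Injective θ) :
    ∃ (α β : Bˣ) (a b : Fˣ), (α : B) * α = algebraMap F B a ∧
      (β : B) * β = algebraMap F B b ∧ (α : B) * β = -(β * α) ∧
      Nonempty (B ≃ₐ[F] QuaternionAlgebra F (a : F) 0 (b : F)) ∧
      ∀ x y, θ (x, y) = QuotientGroup.mk (kleinLift α β x y) := by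
  obtain ⟨α, hα⟩ := QuotientGroup.mk_surjective (θ (-1, 1))
  obtain ⟨β, hβ⟩ := QuotientGroup.mk_surjective (θ (1, -1))
  have hsq : ∀ (ξ : Bˣ) (p : ℤˣ × ℤˣ), QuotientGroup.mk ξ = θ p →
      ∃ a : Fˣ, (ξ : B) * ξ = algebraMap F B a := by
    intro ξ p hξ
    have h1 : ξ * ξ ∈ scalarUnits F B := by
      rw [← QuotientGroup.eq_one_iff, QuotientGroup.mk_mul, hξ, ← map_mul]
      have : p * p = 1 := Prod.ext (Int.units_mul_self _) (Int.units_mul_self _)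
      rw [this, map_one]
    obtain ⟨a, ha⟩ := h1
    exact ⟨a, (congrArg Units.val ha).symm⟩
  obtain ⟨a, ha⟩ := hsq α _ hα
  obtain ⟨b, hb⟩ := hsq β _ hβ
  have hnot : ∀ (ξ : Bˣ) (p : ℤˣ × ℤˣ), QuotientGroup.mk ξ = θ p → p ≠ 1 →
      ∀ x : F, algebraMap F B x ≠ ξ := by
    intro ξ p hξ hp x hx
    refine hp (hθ ?_)
    rw [← hξ, map_one, ← QuotientGroup.mk_one, eq_comm, mk_eq_mk_iff_exists_smul]
    exact ⟨x, by rw [← hx, Units.val_one, Algebra.algebraMap_eq_smul_one]⟩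
  have hα' := hnot α _ hα (by decide)
  have hβ' := hnot β _ hβ (by decide)
  have hαβ : ∀ x : F, x • (α : B) ≠ β := by
    intro x hx
    have h1 := mk_eq_mk_iff_exists_smul.2 ⟨x, hx⟩
    rw [hα, hβ] at h1
    exact absurd (hθ h1) (by decide)
  have hcomm : (QuotientGroup.mk (β * α) : ProjUnits F B) = QuotientGroup.mk (α * β) := by
    rw [QuotientGroup.mk_mul, QuotientGroup.mk_mul, hα, hβ, ← map_mul, ← map_mul, mul_comm]
  obtain ⟨k, hk⟩ := mk_eq_mk_iff_exists_smul.1 hcomm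
  rw [Units.val_mul, Units.val_mul] at hk
  -- Moving `α` past `β` costs a factor `k`, so moving `α²` costs `k²`; but `α²` is central.
  have hk2 : k * k = 1 := by
    have h1 : (k * k) • ((β : B) * (α * α)) = (1 : F) • ((β : B) * (α * α)) := by
      calc (k * k) • ((β : B) * (α * α)) = k • ((k • ((β : B) * α)) * α) := by
            rw [smul_mul_assoc, smul_smul, mul_assoc]
        _ = α * (k • ((β : B) * α)) := by rw [mul_smul_comm, hk, mul_assoc]
        _ = (α * α) * (β : B) := by rw [hk, mul_assoc]
        _ = (1 : F) • ((β : B) * (α * α)) := by rw [one_smul, ha, Algebra.commutes]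
    exact smul_left_injective F (by simp : (β : B) * (α * α) ≠ 0) h1
  have hanti : (α : B) * β = -(β * α) := by
    rcases mul_self_eq_one_iff.1 hk2 with rfl | rfl
    · exact absurd ((one_smul F _).symm.trans hk).symm
        (not_commute_of_finrank_eq_four hdim ha hb hα' hβ' hαβ)
    · rw [← hk, neg_smul, one_smul]
  refine ⟨α, β, a, b, ha, hb, hanti,
    nonempty_algEquiv_quaternionAlgebra hdim ha hb hα' hβ' hαβ hanti, fun x y => ?_⟩
  have h : ((x, y) : ℤˣ × ℤˣ) = (1, y) * (x, 1) := by simp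
  rw [h, map_mul, kleinLift, QuotientGroup.mk_mul]
  congr 1
  · rcases Int.units_eq_one_or y with rfl | rfl
    · rw [if_neg (by decide)]
      exact map_one θ
    · simpa using hβ.symm
  · rcases Int.units_eq_one_or x with rfl | rfl
    · rw [if_neg (by decide)]
      exact map_one θ
    · simpa using hα.symm

/-- Two anticommuting elements with scalar squares define an embedding of the Klein four-group in
`B^*/F^*`. -/
theorem exists_hom_kleinLift [CharZero F] {α β : Bˣ} {a b : Fˣ}
    (hα : (α : B) * α = algebraMap F B a) (hβ : (β : B) * β = algebraMap F B b)
    (hanti : (α : B) * β = -(β * α)) :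
    ∃ θ : ℤˣ × ℤˣ →* ProjUnits F B, Function.Injective θ ∧
      ∀ x y, θ (x, y) = QuotientGroup.mk (kleinLift α β x y) := by
  have hsc : ∀ c : Fˣ, (QuotientGroup.mk (Units.map (algebraMap F B : F →* B) c) :
      ProjUnits F B) = 1 := fun c => (QuotientGroup.eq_one_iff _).2 ⟨c, rfl⟩
  let θ : ℤˣ × ℤˣ →* ProjUnits F B :=
    MonoidHom.mk' (fun q => QuotientGroup.mk (kleinLift α β q.1 q.2)) fun q q' => by
      rw [← QuotientGroup.mk_mul, ← kleinLift_mul hα hβ hanti, QuotientGroup.mk_mul,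
        hsc, one_mul]
      rfl
  have hB2 : ∀ z : Bˣ, (z : B) ≠ -z := fun z h => by
    have : CharZero B := charZero_of_injective_algebraMap (algebraMap F B).injective
    exact z.ne_zero (self_eq_neg.1 h)
  refine ⟨θ, ?_, fun _ _ => rfl⟩
  rw [injective_iff_map_eq_one]
  rintro ⟨x, y⟩ h
  obtain ⟨c, hc⟩ := (QuotientGroup.eq_one_iff _).1 h
  -- An element of the kernel lifts to a central one, while each of `α`, `β`, `βα` anticommutes with
  -- `α` or `β`.
  have hcen : ∀ z : B, (kleinLift α β x y : B) * z = z * kleinLift α β x y := fun z => by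
    rw [← hc]
    exact Algebra.commutes (c : F) z
  have h1 := hcen α
  have h2 := hcen β
  rcases Int.units_eq_one_or x with rfl | rfl <;>
  rcases Int.units_eq_one_or y with rfl | rfl
  · rfl
  · simp [kleinLift, hanti] at h1
    exact absurd h1 (hB2 (β * α))
  · simp [kleinLift, hanti] at h2
    exact absurd h2.symm (hB2 (β * α))
  · simp [kleinLift, ← mul_assoc, hanti] at h1
    exact absurd h1 (hB2 (β * α * α))

end KleinLift

theorem nonempty_kleinFour_mulEquiv : Nonempty (C 2 × C 2 ≃* ℤˣ × ℤˣ) := by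
  have : Fact (Nat.Prime 2) := ⟨Nat.prime_two⟩
  let g : C 2 ≃* ℤˣ := mulEquivOfPrimeCardEq (p := 2) (by simp [C]) (by simp)
  exact ⟨MulEquiv.prodCongr g g⟩

/-! ### Klein four quotients as pairs of independent characters -/

section Characters

variable {G H : Type*} [Group G] [Group H]

theorem nonempty_range_mulEquiv_kleinFour {e f : G →* ℤˣ}
    (hef : Function.Surjective (e.prod f)) {θ : ℤˣ × ℤˣ →* H} (hθ : Function.Injective θ) :
    Nonempty ((θ.comp (e.prod f)).range ≃* C 2 × C 2) := by
  obtain ⟨g⟩ := nonempty_kleinFour_mulEquiv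
  have h : (θ.comp (e.prod f)).range = θ.range := by
    rw [MonoidHom.range_comp, MonoidHom.range_eq_top.2 hef, ← MonoidHom.range_eq_map]
  exact ⟨(MulEquiv.subgroupCongr h).trans ((MonoidHom.ofInjective hθ).symm.trans g.symm)⟩

theorem exists_characters_of_range_mulEquiv [TopologicalSpace G] {ψ : G →* H}
    (hψ : IsLocallyConstant ψ) (h : Nonempty (ψ.range ≃* C 2 × C 2)) :
    ∃ (e f : G →* ℤˣ) (θ : ℤˣ × ℤˣ →* H), IsLocallyConstant e ∧ IsLocallyConstant f ∧
      Function.Surjective (e.prod f) ∧ Function.Injective θ ∧ ∀ g, ψ g = θ (e g, f g) := by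
  obtain ⟨Φ⟩ := h
  obtain ⟨k⟩ := nonempty_kleinFour_mulEquiv
  let Ψ := Φ.trans k
  have hl : IsLocallyConstant ψ.rangeRestrict :=
    IsLocallyConstant.desc _ (Subtype.val : ψ.range → H) hψ Subtype.val_injective
  let π : G →* ℤˣ × ℤˣ := Ψ.toMonoidHom.comp ψ.rangeRestrict
  refine ⟨(MonoidHom.fst _ _).comp π, (MonoidHom.snd _ _).comp π,
    ψ.range.subtype.comp Ψ.symm.toMonoidHom, hl.comp fun x => (Ψ x).1, hl.comp fun x => (Ψ x).2,
    Ψ.surjective.comp ψ.rangeRestrict_surjective,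
    ψ.range.subtype_injective.comp Ψ.symm.injective, fun g => ?_⟩
  change ψ g = (Ψ.symm (Ψ (ψ.rangeRestrict g))).1
  rw [MulEquiv.symm_apply_apply]
  rfl

/-- A proper subgroup of the Klein four-group is killed by one of its three nontrivial characters.
Through Kummer theory, these conditions become that `s`, `t`, `st` are nonsquares. -/
theorem surjective_prod_iff {e f : G →* ℤˣ} : Function.Surjective (e.prod f) ↔
    ¬ (∀ g, e g = 1) ∧ ¬ (∀ g, f g = 1) ∧ ¬ ∀ g, (e * f) g = 1 := by
  constructor
  · intro h
    refine ⟨fun h' => ?_, fun h' => ?_, fun h' => ?_⟩ <;>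
      obtain ⟨g, hg⟩ := h (-1, -1 * -1)
    · exact absurd ((congrArg Prod.fst hg).symm.trans (h' g)) (by decide)
    · obtain ⟨g, hg⟩ := h (1, -1)
      exact absurd ((congrArg Prod.snd hg).symm.trans (h' g)) (by decide)
    · have h1 : e g = -1 := congrArg Prod.fst hg
      have h2 : f g = -1 * -1 := congrArg Prod.snd hg
      have h3 := h' g
      rw [MonoidHom.mul_apply, h1, h2] at h3
      exact absurd h3 (by decide)
  · rintro ⟨h1, h2, h3⟩
    push Not at h1 h2 h3
    obtain ⟨g1, h1⟩ := h1
    obtain ⟨g2, h2⟩ := h2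
    obtain ⟨g3, h3⟩ := h3
    have key : ∀ x1 y1 x2 y2 x3 y3 : ℤˣ, x1 ≠ 1 → y2 ≠ 1 → x3 * y3 ≠ 1 → ∀ z : ℤˣ × ℤˣ,
        z = (1, 1) ∨ z = (x1, y1) ∨ z = (x2, y2) ∨ z = (x3, y3) ∨
          z = (x1 * x2, y1 * y2) ∨ z = (x1 * x3, y1 * y3) ∨ z = (x2 * x3, y2 * y3) := by
      decide
    intro z
    rcases key _ (f g1) (e g2) _ (e g3) (f g3) h1 h2 h3 z with h | h | h | h | h | h | h
    · exact ⟨1, by simp [h]⟩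
    · exact ⟨g1, h.symm⟩
    · exact ⟨g2, h.symm⟩
    · exact ⟨g3, h.symm⟩
    · exact ⟨g1 * g2, by simp [h]⟩
    · exact ⟨g1 * g3, by simp [h]⟩
    · exact ⟨g2 * g3, by simp [h]⟩

end Characters

/-! ### Classes `δ(ψ)` with Klein four image -/

section Delta

variable {F : Type*} [Field F] {B : Type*} [DivisionRing B] [Algebra F B]
  {G : Type*} [Group G] [TopologicalSpace G] [IsTopologicalGroup G]

/-- Classes `δ(ψ)` with `ψ` of image `C₂ × C₂`: they come from anticommuting generators `α`, `β`
of `B` and a pair of independent quadratic characters. -/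
theorem exists_eq_mk_symbolCocycle_of_range_mulEquiv [CharZero F] [Algebra.IsCentral F B]
    (ι : F →+* ℝ) (hdim : Module.finrank F B = 4) (hB : IsTotallyIndefinite F B)
    {ψ : G →* ProjUnits F B} (hψ : IsLocallyConstant ψ)
    (h : Nonempty (ψ.range ≃* C 2 × C 2)) :
    ∃ (e f : G →* ℤˣ) (he : IsLocallyConstant e) (hf : IsLocallyConstant f) (a b : Fˣ),
      Function.Surjective (e.prod f) ∧
      Nonempty (B ≃ₐ[F] QuaternionAlgebra F (a : F) 0 (b : F)) ∧ 0 < ι a ∧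
      delta ψ hψ = H2.mk (symbolCocycle a b (by norm_num : (-1 : Fˣ) ^ 2 = 1) he hf) := by
  obtain ⟨e, f, θ, he, hf, hef, hθ, hψθ⟩ := exists_characters_of_range_mulEquiv hψ h
  obtain ⟨α, β, a, b, hα, hβ, hanti, hiso, hL⟩ := exists_anticommuting_lifts hdim θ hθ
  rcases pos_or_pos_of_isTotallyIndefinite ι hB hα hβ hanti with ha | hb
  · exact ⟨e, f, he, hf, a, b, hef, hiso, ha,
      delta_eq_mk_symbolCocycle ψ hψ hα hβ hanti he hf fun g => by rw [hψθ, hL]⟩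
  · have hanti' : (β : B) * α = -(α * β) := by rw [hanti, neg_neg]
    have hswap : QuaternionAlgebra F (a : F) 0 (b : F) ≃ₐ[F] QuaternionAlgebra F (b : F) 0 a :=
      QuaternionAlgebra.swapEquiv _ _
    refine ⟨f, e, hf, he, b, a, ?_, hiso.map fun i => i.trans hswap, hb,
      delta_eq_mk_symbolCocycle ψ hψ hβ hα hanti' hf he fun g => ?_⟩
    · exact (Equiv.prodComm _ _).surjective.comp hef
    · rw [hψθ, hL, mk_eq_mk_iff_exists_smul]
      by_cases h1 : f g = -1 <;> by_cases h2 : e g = -1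
      -- After the swap the lift is `α^e β^f` instead of `β^f α^e`; they differ by the scalar `-1`
      -- when both characters are nontrivial.
      · exact ⟨-1, by simp [kleinLift, h1, h2, hanti]⟩
      all_goals exact ⟨1, by simp [kleinLift, h1, h2]⟩

theorem exists_delta_eq_mk_symbolCocycle [CharZero F] {a b : Fˣ}
    (h : Nonempty (B ≃ₐ[F] QuaternionAlgebra F (a : F) 0 (b : F))) {e f : G →* ℤˣ}
    (he : IsLocallyConstant e) (hf : IsLocallyConstant f)
    (hef : Function.Surjective (e.prod f)) :
    ∃ (ψ : G →* ProjUnits F B) (hψ : IsLocallyConstant ψ), Nonempty (ψ.range ≃* C 2 × C 2) ∧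
      delta ψ hψ = H2.mk (symbolCocycle a b (by norm_num : (-1 : Fˣ) ^ 2 = 1) he hf) := by
  obtain ⟨i⟩ := h
  let α : B := i.symm ⟨0, 1, 0, 0⟩
  let β : B := i.symm ⟨0, 0, 1, 0⟩
  have hα : α * α = algebraMap F B a := by
    rw [← i.symm.commutes, ← map_mul]
    congr 1
    ext <;> simp
  have hβ : β * β = algebraMap F B b := by
    rw [← i.symm.commutes, ← map_mul]
    congr 1
    ext <;> simp
  have hanti : α * β = -(β * α) := by
    rw [← map_mul, ← map_mul, ← map_neg]
    congr 1
    ext <;> simp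
  have hα0 : α ≠ 0 := fun h => a.ne_zero (by simpa [h] using hα.symm)
  have hβ0 : β ≠ 0 := fun h => b.ne_zero (by simpa [h] using hβ.symm)
  obtain ⟨θ, hθ, hθL⟩ := exists_hom_kleinLift (α := Units.mk0 α hα0) (β := Units.mk0 β hβ0)
    (a := a) (b := b) hα hβ hanti
  have hψ : IsLocallyConstant (θ.comp (e.prod f)) := (he.prodMk hf).comp θ
  exact ⟨θ.comp (e.prod f), hψ, nonempty_range_mulEquiv_kleinFour hef hθ,
    delta_eq_mk_symbolCocycle _ hψ hα hβ hanti he hf fun g => hθL _ _⟩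

end Delta

end QuatDescent

end

/-! ### The characterization of `Δ` for `C₂ × C₂` -/

theorem mainTheorem4
    {K : Type*} [Field K] [NumberField K]
    {F : Type*} [Field F] [NumberField F] [NumberField.IsTotallyReal F] (ι : F →+* ℝ)
    {B : Type*} [DivisionRing B] [Algebra F B] [Algebra.IsCentral F B]
    (hdim : Module.finrank F B = 4) (hB : QuatDescent.IsTotallyIndefinite F B)
    (γ : QuatDescent.H2 (QuatDescent.AbsGal K) Fˣ) :
    γ ∈ QuatDescent.Delta F B K (QuatDescent.C 2 × QuatDescent.C 2) ↔
      ∃ (hγ : γ ^ 2 = 1) (s t : K) (a b : Fˣ),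
        ¬ IsSquare s ∧ ¬ IsSquare t ∧ ¬ IsSquare (s * t) ∧
        Nonempty (B ≃ₐ[F] QuaternionAlgebra F (a : F) 0 (b : F)) ∧
        0 < ι (a : F) ∧
        QuatDescent.pComponent γ hγ = QuatDescent.symbolP s a * QuatDescent.symbolP t b ∧
        QuatDescent.IsQuaternionClass
          (QuaternionAlgebra K (((QuatDescent.signMap ι b : ℤˣ) : ℤ) * s) 0 t)
          (QuatDescent.signComponent ι γ) := by
  open QuatDescent in
  constructor
  · rintro ⟨hγ, ψ, hψ, hQ, rfl⟩
    obtain ⟨e, f, he, hf, a, b, hef, hiso, ha, hδ⟩ :=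
      exists_eq_mk_symbolCocycle_of_range_mulEquiv ι hdim hB hψ hQ
    generalize delta ψ hψ = γ at hγ hδ
    subst hδ
    obtain ⟨r, s, hr, hr0, hre⟩ := exists_sqrt_of_char e he
    obtain ⟨r', t, hr', hr0', hrf⟩ := exists_sqrt_of_char f hf
    obtain ⟨h1, h2, h3⟩ := surjective_prod_iff.1 hef
    refine ⟨hγ, s, t, a, b, ?_, ?_, ?_, hiso, ha, ?_, ?_⟩
    · rwa [hre.isSquare_iff hr0 hr]
    · rwa [hrf.isSquare_iff hr0' hr']
    · rwa [(hre.mul hrf).isSquare_iff (mul_ne_zero hr0 hr0') (by rw [mul_pow, hr, hr', map_mul])]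
    · ext σ
      rw [pComponent_mk_symbolCocycle ι, MonoidHom.mul_apply, hre.symbolP_apply hr0 hr,
        hrf.symbolP_apply hr0' hr']
    · rw [isQuaternionClass_iff hr hr0 hre hr' hr0' hrf he hf,
        signComponent_mk_symbolCocycle ι ha]
  · rintro ⟨hγ, s, t, a, b, hs, ht, hst, hiso, ha, hp, hq⟩
    obtain ⟨r, e, hr, hr0, hre, he⟩ := exists_isSqrtChar s (by rintro rfl; simp at hs)
    obtain ⟨r', f, hr', hr0', hrf, hf⟩ := exists_isSqrtChar t (by rintro rfl; simp at ht)
    have hef : Function.Surjective (e.prod f) := by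
      rw [surjective_prod_iff, ← hre.isSquare_iff hr0 hr, ← hrf.isSquare_iff hr0' hr',
        ← (hre.mul hrf).isSquare_iff (mul_ne_zero hr0 hr0') (t := s * t)
          (by rw [mul_pow, hr, hr', map_mul])]
      exact ⟨hs, ht, hst⟩
    obtain ⟨ψ, hψ, hQ, hδ⟩ := exists_delta_eq_mk_symbolCocycle hiso he hf hef
    refine ⟨hγ, ψ, hψ, hQ, ?_⟩
    rw [hδ]
    -- The constructed `δ(ψ)` need only be compared with `γ` through the two components.
    refine eq_of_components ι hγ (mk_symbolCocycle_sq_eq_one a b _ he hf) ?_ ?_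
    · ext σ
      rw [hp, pComponent_mk_symbolCocycle ι, MonoidHom.mul_apply, hre.symbolP_apply hr0 hr,
        hrf.symbolP_apply hr0' hr']
    · rw [isQuaternionClass_iff hr hr0 hre hr' hr0' hrf he hf] at hq
      rw [hq, signComponent_mk_symbolCocycle ι ha]
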